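/- Work in classical first-order logic with equality over the language $\{0,S,+,\times,\leqslant\}$ of arithmetic, with a fixed standard Gödel numbering. Let $\Sigma_0=\Pi_0$ be the class of bounded formulas. For each $n$, let $\Sigma_{n+1}$ (resp. $\Pi_{n+1}$) be the class of formulas generated from $\Pi_n$ (resp. $\Sigma_n$) by existential (resp. universal) quantification, conjunction, disjunction and bounded quantification, where the negation of a $\Sigma_n$-formula counts as a $\Pi_n$-formula and vice versa (and $\varphi\to\psi$ counts as $\neg\varphi\vee\psi$). Let $\Pi_n\text{-}\mathrm{Th}(\mathbb N)$ be the set of all $\Pi_n$-sentences true in $\mathbb N$. A theory $T$, given by a set of axioms (sentences), is $\Pi_n$-definable if the set of Gödel numbers of its axioms is defined in $\mathbb N$ by a $\Pi_n$-formula; it is $\Sigma_n$-sound if every $\Sigma_n$-sentence provable in $T$ is true in $\mathbb N$; it decides a sentence $\varphi$ if $T\vdash\varphi$ or $T\vdash\neg\varphi$; and it is $\Pi_n$-deciding if it decides every $\Pi_n$-sentence. **Theorem.** Let $n\geqslant 0$ and let $T$ be a $\Pi_n$-definable theory that proves all axioms of Robinson's arithmetic $\mathsf Q$. 1. $T+\Pi_n\text{-}\mathrm{Th}(\mathbb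 N)$ is consistent if and only if $T$ is $\Sigma_n$-sound; and if $n=0$, this holds if and only if $T$ is consistent. 2. If $T+\Pi_n\text{-}\mathrm{Th}(\mathbb N)$ is consistent, then $T$ is not $\Pi_{n+1}$-deciding. Moreover, there is a $\Pi_{n+1}$-sentence $\gamma$ that is true in $\mathbb N$ and such that neither $T$ nor even $T+\Pi_n\text{-}\mathrm{Th}(\mathbb N)$ decides $\gamma$. In particular, for $n=0$, every consistent $\Pi_0$-definable theory extending $\mathsf Q$ leaves some true $\Pi_1$-sentence undecided (Rosser's theorem). -/

import Mathlib

namespace Arith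

open scoped FirstOrder

/-! ## The language of arithmetic `{0, S, +, ×, ≤}` and its standard model -/

/-- Function symbols of arithmetic, graded by arity. -/
inductive Func : ℕ → Type
  | zero : Func 0
  | succ : Func 1
  | add : Func 2
  | mul : Func 2

/-- Relation symbols of arithmetic (besides equality), graded by arity. -/
inductive Rel : ℕ → Type
  | le : Rel 2

/-- The first-order language `{0, S, +, ×, ≤}`. -/
def lang : FirstOrder.Language.{0, 0} := ⟨Func, Rel⟩

/-- The standard model. -/
instance natStructure : lang.Structure ℕ where
  funMap {_} f v :=
    match f with
    | Func.zero => 0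
    | Func.succ => v 0 + 1
    | Func.add => v 0 + v 1
    | Func.mul => v 0 * v 1
  RelMap {_} r v :=
    match r with
    | Rel.le => v 0 ≤ v 1

/-- Terms whose variables are among `x₀, …, x_{k-1}`. -/
abbrev Tm (k : ℕ) : Type := lang.Term (Empty ⊕ Fin k)

/-- Formulas whose free variables are among `x₀, …, x_{k-1}`; a quantifier in front of
a formula of `Fm (k + 1)` binds `x_k`. So `Fm 0 = lang.Sentence`. -/
abbrev Fm (k : ℕ) : Type := lang.BoundedFormula Empty k

/-- The variable `x_i`. -/
abbrev v {k : ℕ} (i : Fin k) : Tm k := FirstOrder.Language.Term.var (Sum.inr i)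

/-- The term `0`. -/
def zero {k : ℕ} : Tm k := FirstOrder.Language.Term.func (L := lang) (l := 0) Func.zero ![]

/-- The term `S t`. -/
def succ {k : ℕ} (t : Tm k) : Tm k := FirstOrder.Language.Term.func (L := lang) (l := 1) Func.succ ![t]

/-- The term `t + u`. -/
def add {k : ℕ} (t u : Tm k) : Tm k := FirstOrder.Language.Term.func (L := lang) (l := 2) Func.add ![t, u]

/-- The term `t × u`. -/
def mul {k : ℕ} (t u : Tm k) : Tm k := FirstOrder.Language.Term.func (L := lang) (l := 2) Func.mul ![t, u]

/-- The atomic formula `t = u`. -/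
def eq {k : ℕ} (t u : Tm k) : Fm k := FirstOrder.Language.BoundedFormula.equal t u

/-- The atomic formula `t ≤ u`. -/
def le {k : ℕ} (t u : Tm k) : Fm k :=
  FirstOrder.Language.BoundedFormula.rel (L := lang) (l := 2) Rel.le ![t, u]

/-- Truth of a sentence in the standard model. -/
def IsTrue (φ : lang.Sentence) : Prop := ℕ ⊨ φ

/-! ## Substitution -/

/-- A term in the variables `x₀, …, x_{k-1}`, seen as a term in `x₀, …, x_k`. -/
def liftTm {k : ℕ} (t : Tm k) : Tm (k + 1) := t.relabel (Sum.map id Fin.castSucc)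

/-- Simultaneous substitution of the terms `σ i` for the variables `x_i` in a term. -/
def substTm {k m : ℕ} (σ : Fin k → Tm m) (t : Tm k) : Tm m :=
  FirstOrder.Language.Term.subst t (Sum.elim (fun e : Empty => e.elim) σ)

/-- Simultaneous (capture-avoiding) substitution of the terms `σ i` for the variables `x_i`
in a formula. -/
def subst : {k : ℕ} → Fm k → {m : ℕ} → (Fin k → Tm m) → Fm m
  | _, .falsum, _, _ => .falsum
  | _, .equal t u, _, σ => .equal (substTm σ t) (substTm σ u)
  | _, .rel R ts, _, σ => .rel R fun i => substTm σ (ts i)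
  | _, .imp φ ψ, _, σ => .imp (subst φ σ) (subst ψ σ)
  | _, .all φ, m, σ =>
      .all (subst φ (Fin.snoc (α := fun _ => Tm (m + 1)) (fun i => liftTm (σ i)) (v (Fin.last m))))

/-- A formula in the variables `x₀, …, x_{k-1}`, seen as a formula in `x₀, …, x_k`. -/
def lift {k : ℕ} (φ : Fm k) : Fm (k + 1) := subst φ fun i => v i.castSucc

/-- A sentence, seen as a formula in the variables `x₀, …, x_{k-1}`. -/
def ofSentence (φ : lang.Sentence) (k : ℕ) : Fm k := subst (k := 0) φ fun i => i.elim0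

/-- `φ(x₀, …, x_{k-1}, t)` for a formula `φ(x₀, …, x_k)`. -/
def inst {k : ℕ} (φ : Fm (k + 1)) (t : Tm k) : Fm k :=
  subst φ (Fin.snoc (α := fun _ => Tm k) (fun i => v i) t)

/-! ## Provability in first-order logic -/

/-- `Provable T φ`: the formula `φ` is derivable from the set of sentences `T` in a
Hilbert calculus of classical first-order logic with equality. -/
inductive Provable (T : lang.Theory) : {k : ℕ} → Fm k → Prop
  | ax {k : ℕ} {φ : lang.Sentence} : φ ∈ T → Provable T (ofSentence φ k)
  | mp {k : ℕ} {φ ψ : Fm k} : Provable T (φ.imp ψ) → Provable T φ → Provable T ψ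
  | gen {k : ℕ} {φ : Fm (k + 1)} : Provable T φ → Provable T φ.all
  | impK {k : ℕ} (φ ψ : Fm k) : Provable T (φ.imp (ψ.imp φ))
  | impS {k : ℕ} (φ ψ χ : Fm k) :
      Provable T ((φ.imp (ψ.imp χ)).imp ((φ.imp ψ).imp (φ.imp χ)))
  | dne {k : ℕ} (φ : Fm k) : Provable T (φ.not.not.imp φ)
  | allElim {k : ℕ} (φ : Fm (k + 1)) (t : Tm k) : Provable T (φ.all.imp (inst φ t))
  | allImp {k : ℕ} (φ : Fm k) (ψ : Fm (k + 1)) :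
      Provable T (((lift φ).imp ψ).all.imp (φ.imp ψ.all))
  | eqRefl {k : ℕ} (t : Tm k) : Provable T (eq t t)
  | eqSubst {k : ℕ} (t u : Tm k) (φ : Fm (k + 1)) :
      Provable T ((eq t u).imp ((inst φ t).imp (inst φ u)))

/-- `T ⊢ φ` for a theory (given by its axioms) `T` and a sentence `φ`. -/
def Proves (T : lang.Theory) (φ : lang.Sentence) : Prop := Provable T (k := 0) φ

/-- `T` is consistent. -/
def Consistent (T : lang.Theory) : Prop := ¬ Proves T ⊥

/-! ## Robinson arithmetic -/

/-- The axioms of Robinson's arithmetic `Q`. -/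
def Q : lang.Theory :=
  { -- `∀ x, S x ≠ 0`
    (eq (succ (v (0 : Fin 1))) zero).not.all,
    -- `∀ x y, S x = S y → x = y`
    ((eq (succ (v (0 : Fin 2))) (succ (v 1))).imp (eq (v 0) (v 1))).all.all,
    -- `∀ x, x ≠ 0 → ∃ y, x = S y`
    ((eq (v (0 : Fin 1)) zero).not.imp (eq (v (0 : Fin 2)) (succ (v 1))).ex).all,
    -- `∀ x, x + 0 = x`
    (eq (add (v (0 : Fin 1)) zero) (v 0)).all,
    -- `∀ x y, x + S y = S (x + y)`
    (eq (add (v (0 : Fin 2)) (succ (v 1))) (succ (add (v 0) (v 1)))).all.all,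
    -- `∀ x, x × 0 = 0`
    (eq (mul (v (0 : Fin 1)) zero) zero).all,
    -- `∀ x y, x × S y = x × y + x`
    (eq (mul (v (0 : Fin 2)) (succ (v 1))) (add (mul (v 0) (v 1)) (v 0))).all.all,
    -- `∀ x y, x ≤ y ↔ ∃ z, z + x = y`
    ((le (v (0 : Fin 2)) (v 1)).iff (eq (add (v (2 : Fin 3)) (v 0)) (v 1)).ex).all.all }

/-- `T` is an extension of `Q`: every axiom of `Q` is a theorem of `T`. -/
def ExtendsQ (T : lang.Theory) : Prop := ∀ φ ∈ Q, Proves T φ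

/-! ## The arithmetical hierarchy -/

/-- The two sides of the hierarchy. -/
inductive Side : Type
  | sigma : Side
  | pi : Side

/-- The other side. -/
def Side.dual : Side → Side
  | .sigma => .pi
  | .pi => .sigma

/-- The bounded quantification `∀ x_k (x_k ≤ t → φ)`, where `x_k` does not occur in `t`. -/
def ballLE {k : ℕ} (t : Tm k) (φ : Fm (k + 1)) : Fm k :=
  ((le (v (Fin.last k)) (liftTm t)).imp φ).all

/-- The bounded quantification `∃ x_k (x_k ≤ t ∧ φ)`, where `x_k` does not occur in `t`. -/
def bexLE {k : ℕ} (t : Tm k) (φ : Fm (k + 1)) : Fm k :=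
  (le (v (Fin.last k)) (liftTm t) ⊓ φ).ex

/-- `Hier .sigma n φ`: `φ` is a `Σ_n`-formula; `Hier .pi n φ`: `φ` is a `Π_n`-formula.
`Σ_0 = Π_0` is the class of bounded formulas; `Σ_{n+1}` contains `Π_n` and is closed under
existential quantifiers; `Π_{n+1}` contains `Σ_n` and is closed under universal quantifiers;
all the classes are closed under bounded quantifiers, and `φ → ψ` is in a class
when `ψ` is in it and `φ` is in the dual one. As `¬`, `∧`, `∨` are built from `→` and `⊥`, the
classes are closed under conjunction and disjunction, and negation leads from each to
its dual. -/
inductive Hier : Side → ℕ → {k : ℕ} → Fm k → Prop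
  | falsum (s : Side) (n : ℕ) {k : ℕ} : Hier s n (⊥ : Fm k)
  | eq (s : Side) (n : ℕ) {k : ℕ} (t u : Tm k) : Hier s n (eq t u)
  | le (s : Side) (n : ℕ) {k : ℕ} (t u : Tm k) : Hier s n (le t u)
  | imp {s : Side} {n k : ℕ} {φ ψ : Fm k} :
      Hier s.dual n φ → Hier s n ψ → Hier s n (φ.imp ψ)
  | ballLE {s : Side} {n k : ℕ} (t : Tm k) {φ : Fm (k + 1)} :
      Hier s n φ → Hier s n (ballLE t φ)
  | bexLE {s : Side} {n k : ℕ} (t : Tm k) {φ : Fm (k + 1)} :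
      Hier s n φ → Hier s n (bexLE t φ)
  | up {s : Side} {n k : ℕ} {φ : Fm k} : Hier s.dual n φ → Hier s (n + 1) φ
  | ex {n k : ℕ} {φ : Fm (k + 1)} : Hier .sigma (n + 1) φ → Hier .sigma (n + 1) φ.ex
  | all {n k : ℕ} {φ : Fm (k + 1)} : Hier .pi (n + 1) φ → Hier .pi (n + 1) φ.all

/-- `Σ_n`-formulas. -/
abbrev IsSigma (n : ℕ) {k : ℕ} (φ : Fm k) : Prop := Hier .sigma n φ

/-- `Π_n`-formulas. -/
abbrev IsPi (n : ℕ) {k : ℕ} (φ : Fm k) : Prop := Hier .pi n φ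

/-- `Π_n-Th(ℕ)`, the set of all true `Π_n`-sentences. -/
def PiTh (n : ℕ) : lang.Theory := {φ | IsPi n (k := 0) φ ∧ IsTrue φ}

/-- `T` is `Σ_n`-sound: every `Σ_n`-sentence provable in `T` is true. -/
def SigmaSound (n : ℕ) (T : lang.Theory) : Prop :=
  ∀ φ : lang.Sentence, IsSigma n (k := 0) φ → Proves T φ → IsTrue φ

/-- `T` decides `φ`. -/
def Decides (T : lang.Theory) (φ : lang.Sentence) : Prop :=
  Proves T φ ∨ Proves T (FirstOrder.Language.BoundedFormula.not φ)

/-- `T` is `Π_n`-deciding: it decides every `Π_n`-sentence. -/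
def PiDeciding (n : ℕ) (T : lang.Theory) : Prop :=
  ∀ φ : lang.Sentence, IsPi n (k := 0) φ → Decides T φ

/-! ## Gödel numbers and definable theories -/

/-- Gödel numbers of terms. -/
def codeTm {k : ℕ} : Tm k → ℕ
  | .var (Sum.inr i) => Nat.pair 0 i
  | .func Func.zero _ => Nat.pair 1 0
  | .func Func.succ ts => Nat.pair 2 (codeTm (ts 0))
  | .func Func.add ts => Nat.pair 3 (Nat.pair (codeTm (ts 0)) (codeTm (ts 1)))
  | .func Func.mul ts => Nat.pair 4 (Nat.pair (codeTm (ts 0)) (codeTm (ts 1)))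

/-- Gödel numbers of formulas. -/
def code : {k : ℕ} → Fm k → ℕ
  | _, .falsum => Nat.pair 0 0
  | _, .equal t u => Nat.pair 1 (Nat.pair (codeTm t) (codeTm u))
  | _, .rel Rel.le ts => Nat.pair 2 (Nat.pair (codeTm (ts 0)) (codeTm (ts 1)))
  | _, .imp φ ψ => Nat.pair 3 (Nat.pair (code φ) (code ψ))
  | _, .all φ => Nat.pair 4 (code φ)

theorem codeTm_injective {k : ℕ} : Function.Injective (codeTm (k := k)) := by
  intro t
  induction t with
  | var x =>
    rcases x with e | i
    · exact e.elim
    · intro u h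
      rcases u with (e | j) | ⟨f, ts⟩
      · exact e.elim
      · simp [codeTm, Nat.pair_eq_pair] at h
        rw [Fin.ext h]
      · cases f <;> simp [codeTm, Nat.pair_eq_pair] at h
  | func f ts ih =>
    intro u h
    rcases u with (e | j) | ⟨g, us⟩
    · exact e.elim
    · cases f <;> simp [codeTm, Nat.pair_eq_pair] at h
    · cases f <;> cases g <;> simp [codeTm, Nat.pair_eq_pair] at h <;> congr 1 <;> funext i
      · exact i.elim0
      · rw [Subsingleton.elim i 0]; exact ih 0 h
      · fin_cases i
        · exact ih 0 h.1
        · exact ih 1 h.2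
      · fin_cases i
        · exact ih 0 h.1
        · exact ih 1 h.2

/-- Distinct formulas in the same variables have distinct Gödel numbers. -/
theorem code_injective {k : ℕ} : Function.Injective (code (k := k)) := by
  intro φ
  induction φ with
  | falsum =>
    intro ψ h
    rcases ψ with _ | _ | ⟨R, us⟩ | _ | _
    · rfl
    all_goals first | (cases R; simp [code, Nat.pair_eq_pair] at h) |
      simp [code, Nat.pair_eq_pair] at h
  | equal t u =>
    intro ψ h
    rcases ψ with _ | _ | ⟨R, us⟩ | _ | _
    all_goals first | (cases R; simp [code, Nat.pair_eq_pair] at h) |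
      simp [code, Nat.pair_eq_pair] at h
    rw [codeTm_injective h.1, codeTm_injective h.2]
  | rel R ts =>
    cases R
    intro ψ h
    rcases ψ with _ | _ | ⟨R, us⟩ | _ | _
    rotate_left 2
    · cases R
      simp [code, Nat.pair_eq_pair] at h
      congr 1
      funext i
      fin_cases i
      · exact codeTm_injective h.1
      · exact codeTm_injective h.2
    all_goals simp [code, Nat.pair_eq_pair] at h
  | imp φ ψ ih₁ ih₂ =>
    intro χ h
    rcases χ with _ | _ | ⟨R, us⟩ | _ | _
    all_goals first | (cases R; simp [code, Nat.pair_eq_pair] at h) |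
      simp [code, Nat.pair_eq_pair] at h
    rw [ih₁ h.1, ih₂ h.2]
  | all φ ih =>
    intro χ h
    rcases χ with _ | _ | ⟨R, us⟩ | _ | _
    all_goals first | (cases R; simp [code, Nat.pair_eq_pair] at h) |
      simp [code, Nat.pair_eq_pair] at h
    rw [ih h]

/-- `T` is `Π_n`-definable: the set of Gödel numbers of the axioms of `T` is defined in `ℕ` by a
`Π_n`-formula `α(x₀)`. -/
def PiDefinable (n : ℕ) (T : lang.Theory) : Prop :=
  ∃ α : Fm 1, IsPi n α ∧
    ∀ m : ℕ, α.Realize (M := ℕ) Empty.elim (fun _ => m) ↔ ∃ φ ∈ T, code (k := 0) φ = m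

end Arith

namespace Arith

open scoped FirstOrder

/-! ## Substitution -/

/-! Provability is handled through models. Completeness of the calculus (`proves_of_models`) reduces
a derivability claim to truth in every model of the axioms, and soundness (`Proves.models`) gives
the converse.

The engine is `Hier.transfer`. In a model of `Q` every element below a numeral is a numeral, so
bounded formulas keep at numerals the truth value they have in `ℕ`. If the model also satisfies the
true `Π_m`-sentences, then true `Σ_{m+1}`-sentences hold in it, and `Π_{m+1}`-sentences that hold in
it are true.

Part 1. The negation of a false `Σ_n`-theorem of `T` would be an axiom of `PiTh n`. Conversely, by
compactness, an inconsistency of `T ∪ PiTh n` involves finitely many true `Π_n`-sentences; `T`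
refutes their conjunction, and so proves a false `Σ_n`-sentence. For `n = 0` every model of `Q`
already satisfies `PiTh 0`.

Part 2. Let `U = T ∪ PiTh n`. Provability in `U` has the form `∃ y, φ(x, y)` with `φ` in `Π_n`
(`SDef n`). Indeed, inductively generated sets are as simple as their rules (`SDef.clo`, by coding
derivations with the beta function), and all syntax is generated inductively. The set `PiTh n`
itself has this form by induction on `n` (`exists_axiomCodes_piTh`): truth at one level is
irrefutability from the truths of the level below.

Rosser's argument then applies to `U` (`exists_undecided`). Let `a(x, y)` and `b(x, y)` say that `y`
witnesses that `U` proves, respectively refutes, the formula `x` at its own code. A diagonal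
sentence `δ` asserts that some witness of its refutation has no witness of its proof at or below it.
Both predicates are `Π_n`, so `U` is correct about standard witnesses, and it compares a numeral
with any element. Consistency therefore excludes both a proof and a refutation of `δ`, and `¬ δ` is
a true `Π_{n+1}`-sentence. What `U` leaves undecided, `T` leaves undecided. -/

theorem substTm_var {k m : ℕ} (σ : Fin k → Tm m) (i : Fin k) : substTm σ (v i) = σ i := rfl

theorem substTm_congr {k m : ℕ} {σ τ : Fin k → Tm m} (h : ∀ i, σ i = τ i) (t : Tm k) :
    substTm σ t = substTm τ t := by
  rw [funext h]

theorem liftTm_eq_substTm {k : ℕ} (t : Tm k) : liftTm t = substTm (fun i => v i.castSucc) t := by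
  induction t with
  | var x => rcases x with e | i; exacts [e.elim, rfl]
  | func f ts ih =>
    simp only [liftTm, substTm, FirstOrder.Language.Term.relabel,
      FirstOrder.Language.Term.subst] at ih ⊢
    congr 1
    funext i
    exact ih i

theorem substTm_substTm {k m l : ℕ} (σ : Fin k → Tm m) (τ : Fin m → Tm l) (t : Tm k) :
    substTm τ (substTm σ t) = substTm (fun i => substTm τ (σ i)) t := by
  induction t with
  | var x => rcases x with e | i; exacts [e.elim, rfl]
  | func f ts ih =>
    simp only [substTm, FirstOrder.Language.Term.subst] at ih ⊢
    congr 1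
    funext i
    exact ih i

theorem substTm_id {k : ℕ} (t : Tm k) : substTm (fun i => v i) t = t := by
  induction t with
  | var x => rcases x with e | i; exacts [e.elim, rfl]
  | func f ts ih =>
    simp only [substTm, FirstOrder.Language.Term.subst] at ih ⊢
    congr 1
    funext i
    exact ih i

@[simp] theorem liftTm_var {k : ℕ} (i : Fin k) : liftTm (v i) = v i.castSucc := rfl

/-- The substitution `σ` carried under a quantifier. -/
abbrev snocVar {k m : ℕ} (σ : Fin k → Tm m) : Fin (k + 1) → Tm (m + 1) :=
  Fin.snoc (α := fun _ => Tm (m + 1)) (fun i => liftTm (σ i)) (v (Fin.last m))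

theorem substTm_snocVar_liftTm {k m : ℕ} (σ : Fin k → Tm m) (t : Tm k) :
    substTm (snocVar σ) (liftTm t) = liftTm (substTm σ t) := by
  rw [liftTm_eq_substTm, liftTm_eq_substTm, substTm_substTm, substTm_substTm]
  refine substTm_congr (fun i => ?_) t
  rw [substTm_var, snocVar, Fin.snoc_castSucc, liftTm_eq_substTm]

@[simp] theorem substTm_zero {k m : ℕ} (σ : Fin k → Tm m) : substTm σ zero = zero := by
  simp only [zero, substTm, FirstOrder.Language.Term.subst]
  congr 1
  funext i
  exact i.elim0

@[simp] theorem substTm_succ {k m : ℕ} (σ : Fin k → Tm m) (t : Tm k) :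
    substTm σ (succ t) = succ (substTm σ t) := by
  simp only [succ, substTm, FirstOrder.Language.Term.subst]
  congr 1
  funext i
  fin_cases i
  rfl

@[simp] theorem substTm_add {k m : ℕ} (σ : Fin k → Tm m) (t u : Tm k) :
    substTm σ (add t u) = add (substTm σ t) (substTm σ u) := by
  simp only [add, substTm, FirstOrder.Language.Term.subst]
  congr 1
  funext i
  fin_cases i <;> rfl

@[simp] theorem substTm_mul {k m : ℕ} (σ : Fin k → Tm m) (t u : Tm k) :
    substTm σ (mul t u) = mul (substTm σ t) (substTm σ u) := by
  simp only [mul, substTm, FirstOrder.Language.Term.subst]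
  congr 1
  funext i
  fin_cases i <;> rfl

theorem subst_eq {k m : ℕ} (σ : Fin k → Tm m) (t u : Tm k) :
    subst (eq t u) σ = eq (substTm σ t) (substTm σ u) := rfl

theorem subst_le {k m : ℕ} (σ : Fin k → Tm m) (t u : Tm k) :
    subst (le t u) σ = le (substTm σ t) (substTm σ u) := by
  simp only [le, subst]
  congr 1
  funext i
  fin_cases i <;> rfl

theorem substTm_snoc_liftTm {k m : ℕ} (σ : Fin k → Tm m) (t : Tm m) (u : Tm k) :
    substTm (Fin.snoc (α := fun _ => Tm m) σ t) (liftTm u) = substTm σ u := by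
  rw [liftTm_eq_substTm, substTm_substTm]
  exact substTm_congr (fun i => by rw [substTm_var, Fin.snoc_castSucc]) u

theorem snocVar_comp {k m l : ℕ} (σ : Fin k → Tm m) (τ : Fin m → Tm l) (i : Fin (k + 1)) :
    substTm (snocVar τ) (snocVar σ i) = snocVar (fun i => substTm τ (σ i)) i := by
  refine Fin.lastCases ?_ (fun i => ?_) i
  · simp [snocVar, substTm_var]
  · simp only [snocVar, Fin.snoc_castSucc]
    exact substTm_snocVar_liftTm τ (σ i)

theorem subst_subst {k : ℕ} (φ : Fm k) {m l : ℕ} (σ : Fin k → Tm m) (τ : Fin m → Tm l) :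
    subst (subst φ σ) τ = subst φ (fun i => substTm τ (σ i)) := by
  induction φ generalizing m l with
  | falsum => rfl
  | equal t u => simp only [subst, substTm_substTm]
  | rel R ts => simp only [subst, substTm_substTm]
  | imp φ ψ ih₁ ih₂ => simp only [subst, ih₁, ih₂]
  | all φ ih =>
    simp only [subst]
    rw [ih]
    congr 2
    funext i
    exact snocVar_comp σ τ i

theorem snocVar_id {k : ℕ} : snocVar (fun i : Fin k => v i) = fun i => v i := by
  funext i
  refine Fin.lastCases ?_ (fun i => ?_) i <;> simp [snocVar]

theorem subst_id {k : ℕ} (φ : Fm k) : subst φ (fun i => v i) = φ := by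
  induction φ with
  | falsum => rfl
  | equal t u => simp only [subst, substTm_id]
  | rel R ts => simp only [subst, substTm_id]
  | imp φ ψ ih₁ ih₂ => simp only [subst, ih₁, ih₂]
  | all φ ih =>
    simp only [subst]
    congr 1
    exact (congrArg (subst φ) snocVar_id).trans ih

theorem ofSentence_zero (φ : lang.Sentence) : ofSentence φ 0 = φ := by
  refine Eq.trans ?_ (subst_id (k := 0) φ)
  exact congrArg (subst (k := 0) φ) (funext fun i => i.elim0)

/-- This is `allElim` read at the fresh variable: it opens a lifted universal formula, as
`provable_lift_all` requires. -/
theorem inst_subst_lift_last {k : ℕ} (φ : Fm (k + 1)) :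
    inst (subst φ (snocVar fun i : Fin k => v i.castSucc)) (v (Fin.last k)) = φ := by
  rw [inst, subst_subst]
  refine Eq.trans ?_ (subst_id φ)
  congr 1
  funext i
  refine Fin.lastCases ?_ (fun i => ?_) i <;> simp [snocVar, substTm_var]

theorem inst_subst_snocVar {k m : ℕ} (φ : Fm (k + 1)) (σ : Fin k → Tm m) (t : Tm m) :
    inst (subst φ (snocVar σ)) t = subst φ (Fin.snoc (α := fun _ => Tm m) σ t) := by
  rw [inst, subst_subst]
  congr 1
  funext i
  refine Fin.lastCases ?_ (fun i => ?_) i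
  · simp [snocVar, substTm_var]
  · simp only [snocVar, Fin.snoc_castSucc, liftTm_eq_substTm, substTm_substTm, substTm_var]
    exact substTm_id _

/-! ## Values of terms and satisfaction -/

section Semantics

variable {M : Type*} [lang.Structure M]

/-- The value of a term. -/
def val {k : ℕ} (t : Tm k) (x : Fin k → M) : M := t.realize (Sum.elim Empty.elim x)

/-- Satisfaction of a formula. -/
def Sat {k : ℕ} (φ : Fm k) (x : Fin k → M) : Prop := φ.Realize Empty.elim x

@[simp] theorem val_var {k : ℕ} (i : Fin k) (x : Fin k → M) : val (v i) x = x i := rfl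

theorem val_substTm {k m : ℕ} (σ : Fin k → Tm m) (t : Tm k) (x : Fin m → M) :
    val (substTm σ t) x = val t fun i => val (σ i) x := by
  simp only [val, substTm, FirstOrder.Language.Term.realize_subst]
  congr 1
  funext a
  rcases a with e | i
  exacts [e.elim, rfl]

@[simp] theorem val_liftTm {k : ℕ} (t : Tm k) (x : Fin (k + 1) → M) :
    val (liftTm t) x = val t fun i => x i.castSucc := by
  rw [liftTm_eq_substTm, val_substTm]; rfl

@[simp] theorem sat_imp {k : ℕ} (φ ψ : Fm k) (x : Fin k → M) :
    Sat (φ.imp ψ) x ↔ (Sat φ x → Sat ψ x) := Iff.rfl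

@[simp] theorem sat_bot {k : ℕ} (x : Fin k → M) : Sat (⊥ : Fm k) x ↔ False := Iff.rfl

@[simp] theorem sat_not {k : ℕ} (φ : Fm k) (x : Fin k → M) : Sat φ.not x ↔ ¬ Sat φ x := Iff.rfl

@[simp] theorem sat_inf {k : ℕ} (φ ψ : Fm k) (x : Fin k → M) :
    Sat (φ ⊓ ψ) x ↔ Sat φ x ∧ Sat ψ x := FirstOrder.Language.BoundedFormula.realize_inf

@[simp] theorem sat_sup {k : ℕ} (φ ψ : Fm k) (x : Fin k → M) :
    Sat (φ ⊔ ψ) x ↔ Sat φ x ∨ Sat ψ x := FirstOrder.Language.BoundedFormula.realize_sup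

@[simp] theorem sat_iff {k : ℕ} (φ ψ : Fm k) (x : Fin k → M) :
    Sat (φ.iff ψ) x ↔ (Sat φ x ↔ Sat ψ x) := FirstOrder.Language.BoundedFormula.realize_iff

@[simp] theorem sat_all {k : ℕ} (φ : Fm (k + 1)) (x : Fin k → M) :
    Sat φ.all x ↔ ∀ a : M, Sat φ (Fin.snoc (α := fun _ => M) x a) := Iff.rfl

@[simp] theorem sat_ex {k : ℕ} (φ : Fm (k + 1)) (x : Fin k → M) :
    Sat φ.ex x ↔ ∃ a : M, Sat φ (Fin.snoc (α := fun _ => M) x a) :=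
  FirstOrder.Language.BoundedFormula.realize_ex

@[simp] theorem sat_eq {k : ℕ} (t u : Tm k) (x : Fin k → M) :
    Sat (eq t u) x ↔ val t x = val u x := Iff.rfl

@[simp] theorem sat_equal {k : ℕ} (t u : Tm k) (x : Fin k → M) :
    Sat (FirstOrder.Language.BoundedFormula.equal t u : Fm k) x ↔ val t x = val u x := Iff.rfl

theorem sat_subst {k : ℕ} (φ : Fm k) {m : ℕ} (σ : Fin k → Tm m) (x : Fin m → M) :
    Sat (subst φ σ) x ↔ Sat φ fun i => val (σ i) x := by
  induction φ generalizing m with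
  | falsum => rfl
  | equal t u => simp only [subst, sat_equal, val_substTm]
  | rel R ts =>
    simp only [subst]
    change FirstOrder.Language.Structure.RelMap R (fun i => val (substTm σ (ts i)) x) ↔
      FirstOrder.Language.Structure.RelMap R (fun i => val (ts i) _)
    simp only [val_substTm]
  | imp φ ψ ih₁ ih₂ => simp only [subst, sat_imp, ih₁, ih₂]
  | all φ ih =>
    simp only [subst, sat_all, ih]
    refine forall_congr' fun a => ?_
    have : (fun i => val (snocVar σ i) (Fin.snoc (α := fun _ => M) x a)) =
        Fin.snoc (α := fun _ => M) (fun i => val (σ i) x) a := by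
      funext i
      refine Fin.lastCases ?_ (fun i => ?_) i <;> simp [snocVar]
    rw [← this]

@[simp] theorem sat_inst {k : ℕ} (φ : Fm (k + 1)) (t : Tm k) (x : Fin k → M) :
    Sat (inst φ t) x ↔ Sat φ (Fin.snoc (α := fun _ => M) x (val t x)) := by
  rw [inst, sat_subst]
  have : (fun i => val ((Fin.snoc (α := fun _ => Tm k) (fun i => v i) t : Fin (k + 1) → Tm k) i) x)
      = Fin.snoc (α := fun _ => M) x (val t x) := by
    funext i
    refine Fin.lastCases ?_ (fun i => ?_) i <;> simp
  rw [this]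

@[simp] theorem sat_lift {k : ℕ} (φ : Fm k) (x : Fin (k + 1) → M) :
    Sat (lift φ) x ↔ Sat φ fun i => x i.castSucc := by
  rw [lift, sat_subst]; rfl

theorem models_iff_sat (φ : lang.Sentence) (x : Fin 0 → M) : M ⊨ φ ↔ Sat (k := 0) φ x := by
  unfold FirstOrder.Language.Sentence.Realize FirstOrder.Language.Formula.Realize Sat
  rw [Subsingleton.elim (default : Empty → M) Empty.elim,
    Subsingleton.elim (default : Fin 0 → M) x]

@[simp] theorem sat_ofSentence (φ : lang.Sentence) {k : ℕ} (x : Fin k → M) :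
    Sat (ofSentence φ k) x ↔ M ⊨ φ := by
  rw [ofSentence, sat_subst, models_iff_sat]

/-- Soundness of the Hilbert calculus. -/
theorem Provable.sat [Nonempty M] {T : lang.Theory} (hM : M ⊨ T) {k : ℕ} {φ : Fm k}
    (h : Provable T φ) (x : Fin k → M) : Sat φ x := by
  induction h with
  | ax h => exact (sat_ofSentence _ _).2 (hM.realize_of_mem _ h)
  | mp _ _ ih₁ ih₂ => exact ih₁ x (ih₂ x)
  | gen _ ih => exact fun a => ih _
  | impK φ ψ => exact fun h _ => h
  | impS φ ψ χ => exact fun h₁ h₂ h₃ => h₁ h₃ (h₂ h₃)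
  | dne φ => exact fun h => by_contra h
  | allElim φ t => exact fun h => (sat_inst φ t x).2 (h _)
  | allImp φ ψ =>
    intro h₁ h₂ a
    refine h₁ a ((sat_lift _ _).2 ?_)
    simp only [Fin.snoc_castSucc]
    exact h₂
  | eqRefl t => rfl
  | eqSubst t u φ =>
    rw [sat_imp, sat_imp, sat_inst, sat_inst, sat_eq]
    intro h₁ h₂
    rwa [← h₁]

theorem Proves.models [Nonempty M] {T : lang.Theory} (hM : M ⊨ T) {φ : lang.Sentence}
    (h : Proves T φ) : M ⊨ φ :=
  (models_iff_sat φ Fin.elim0).2 (Provable.sat hM h _)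

theorem consistent_of_models [Nonempty M] {T : lang.Theory} (hM : M ⊨ T) : Consistent T :=
  fun h => Proves.models hM h

end Semantics

/-! ## The hierarchy is closed under substitution -/

theorem subst_ballLE {k m : ℕ} (t : Tm k) (φ : Fm (k + 1)) (σ : Fin k → Tm m) :
    subst (ballLE t φ) σ = ballLE (substTm σ t) (subst φ (snocVar σ)) := by
  simp only [ballLE, subst, le]
  congr 3
  funext i
  fin_cases i
  · simp [substTm_var]
  · exact substTm_snocVar_liftTm σ t

theorem subst_bexLE {k m : ℕ} (t : Tm k) (φ : Fm (k + 1)) (σ : Fin k → Tm m) :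
    subst (bexLE t φ) σ = bexLE (substTm σ t) (subst φ (snocVar σ)) := by
  -- Only the equality of the guards is taken from the universal case; the remaining connectives
  -- commute with substitution by definition.
  have := subst_ballLE t φ.not σ
  simp only [ballLE, subst, FirstOrder.Language.BoundedFormula.all.injEq,
    FirstOrder.Language.BoundedFormula.imp.injEq, FirstOrder.Language.BoundedFormula.not] at this
  simp only [bexLE, subst, FirstOrder.Language.BoundedFormula.ex, Min.min,
    FirstOrder.Language.BoundedFormula.not, this.1]
  rfl

theorem Hier.subst {s : Side} {n k : ℕ} {φ : Fm k} (h : Hier s n φ) {m : ℕ} (σ : Fin k → Tm m) :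
    Hier s n (Arith.subst φ σ) := by
  induction h generalizing m with
  | falsum s n => exact .falsum s n
  | eq s n t u => exact .eq s n _ _
  | le s n t u =>
    rw [subst_le]
    exact .le s n _ _
  | imp _ _ ih₁ ih₂ => exact .imp (ih₁ σ) (ih₂ σ)
  | ballLE t _ ih => rw [subst_ballLE]; exact .ballLE _ (ih _)
  | bexLE t _ ih => rw [subst_bexLE]; exact .bexLE _ (ih _)
  | up _ ih => exact .up (ih σ)
  | ex _ ih => exact .ex (ih _)
  | all _ ih => exact .all (ih _)

/-- At level 0 only the rules common to both sides and all levels apply: `up`, `ex` and `all`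
conclude at a successor level. -/
theorem Hier.of_zero {s : Side} {n k : ℕ} {φ : Fm k} (h : Hier s n φ) (hn : n = 0) (s' : Side)
    (n' : ℕ) : Hier s' n' φ := by
  induction h generalizing s' n' with
  | falsum => exact .falsum _ _
  | eq => exact .eq _ _ _ _
  | le => exact .le _ _ _ _
  | imp _ _ ih₁ ih₂ => exact .imp (ih₁ hn _ _) (ih₂ hn _ _)
  | ballLE t _ ih => exact .ballLE _ (ih hn _ _)
  | bexLE t _ ih => exact .bexLE _ (ih hn _ _)
  | up => cases hn
  | ex => cases hn
  | all => cases hn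

theorem Hier.succ {s : Side} {n k : ℕ} {φ : Fm k} (h : Hier s n φ) : Hier s (n + 1) φ := by
  induction h with
  | falsum => exact .falsum _ _
  | eq => exact .eq _ _ _ _
  | le => exact .le _ _ _ _
  | imp _ _ ih₁ ih₂ => exact .imp ih₁ ih₂
  | ballLE t _ ih => exact .ballLE _ ih
  | bexLE t _ ih => exact .bexLE _ ih
  | up _ ih => exact .up ih
  | ex _ ih => exact .ex ih
  | all _ ih => exact .all ih

theorem Hier.not {s : Side} {n k : ℕ} {φ : Fm k} (h : Hier s.dual n φ) : Hier s n φ.not :=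
  .imp h (.falsum _ _)

theorem Side.dual_dual (s : Side) : s.dual.dual = s := by cases s <;> rfl

theorem Hier.inf {s : Side} {n k : ℕ} {φ ψ : Fm k} (h₁ : Hier s n φ) (h₂ : Hier s n ψ) :
    Hier s n (φ ⊓ ψ) :=
  Hier.not (Hier.imp (by rwa [Side.dual_dual]) (Hier.not (by rwa [Side.dual_dual])))

theorem Hier.sup {s : Side} {n k : ℕ} {φ ψ : Fm k} (h₁ : Hier s n φ) (h₂ : Hier s n ψ) :
    Hier s n (φ ⊔ ψ) :=
  Hier.imp (Hier.not (by rwa [Side.dual_dual])) h₂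

/-! ## Completeness of the Hilbert calculus -/

/-- Propositional consequence of a set of formulas together with the theorems of `T`. -/
inductive Der (T : lang.Theory) {k : ℕ} (Γ : Set (Fm k)) : Fm k → Prop
  | hyp {φ : Fm k} : φ ∈ Γ → Der T Γ φ
  | thm {φ : Fm k} : Provable T φ → Der T Γ φ
  | mp {φ ψ : Fm k} : Der T Γ (φ.imp ψ) → Der T Γ φ → Der T Γ ψ

section Calculus

variable {T : lang.Theory} {k : ℕ}

theorem Der.mono {Γ Δ : Set (Fm k)} (h : Γ ⊆ Δ) {φ : Fm k} (d : Der T Γ φ) : Der T Δ φ := by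
  induction d with
  | hyp h' => exact .hyp (h h')
  | thm h' => exact .thm h'
  | mp _ _ ih₁ ih₂ => exact .mp ih₁ ih₂

theorem provable_imp_self (φ : Fm k) : Provable T (φ.imp φ) :=
  .mp (.mp (.impS φ (φ.imp φ) φ) (.impK _ _)) (.impK _ _)

theorem provable_efq (φ : Fm k) : Provable T ((⊥ : Fm k).imp φ) :=
  .mp (.mp (.impS ⊥ φ.not.not φ) (.mp (.impK _ _) (.dne φ))) (.impK ⊥ φ.not)

/-- Deduction theorem. Generalization is not a rule of `Der`, so the schemes K and S suffice. -/
theorem Der.imp_intro {Γ : Set (Fm k)} {φ ψ : Fm k} (d : Der T (insert φ Γ) ψ) :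
    Der T Γ (φ.imp ψ) := by
  induction d with
  | hyp h =>
    rcases h with rfl | h
    · exact .thm (provable_imp_self _)
    · exact .mp (.thm (.impK _ _)) (.hyp h)
  | thm h => exact .mp (.thm (.impK _ _)) (.thm h)
  | mp _ _ ih₁ ih₂ => exact .mp (.mp (.thm (.impS _ _ _)) ih₁) ih₂

theorem Der.provable {φ : Fm k} (d : Der T ∅ φ) : Provable T φ := by
  induction d with
  | hyp h => exact h.elim
  | thm h => exact h
  | mp _ _ ih₁ ih₂ => exact .mp ih₁ ih₂

theorem provable_lift_all (φ : Fm (k + 1)) : Provable T ((lift φ.all).imp φ) := by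
  have := Provable.allElim (T := T) (subst φ (snocVar fun i : Fin k => v i.castSucc))
    (v (Fin.last k))
  rwa [inst_subst_lift_last] at this

theorem provable_all_mp (φ ψ : Fm (k + 1)) :
    Provable T ((φ.imp ψ).all.imp (φ.all.imp ψ.all)) := by
  have h : Provable T ((lift (φ.imp ψ).all).imp ((lift φ.all).imp ψ)) := by
    refine Der.provable (Der.imp_intro (Der.imp_intro ?_))
    exact .mp (.mp (.thm (provable_lift_all (φ.imp ψ))) (.hyp (by simp)))
      (.mp (.thm (provable_lift_all φ)) (.hyp (by simp)))
  refine Der.provable (Der.imp_intro ?_)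
  exact .mp (.thm (.allImp _ _)) (.mp (.thm (.mp (.allImp _ _) (.gen h))) (.hyp (by simp)))

/-- The last variable does not occur in lifted hypotheses, so it may be generalized; `allImp` serves
for the hypotheses and `provable_all_mp` for modus ponens. -/
theorem Der.all_intro {Γ : Set (Fm k)} {φ : Fm (k + 1)} (d : Der T (lift '' Γ) φ) :
    Der T Γ φ.all := by
  induction d with
  | hyp h =>
    obtain ⟨χ, hχ, rfl⟩ := h
    exact .mp (.thm (.mp (.allImp _ _) (.gen (provable_imp_self _)))) (.hyp hχ)
  | thm h => exact .thm (.gen h)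
  | mp _ _ ih₁ ih₂ => exact .mp (.mp (.thm (provable_all_mp _ _)) ih₁) ih₂

theorem Der.of_sUnion {c : Set (Set (Fm k))} (hc : IsChain (· ⊆ ·) c) (hne : c.Nonempty)
    {φ : Fm k} (d : Der T (⋃₀ c) φ) : ∃ Γ ∈ c, Der T Γ φ := by
  induction d with
  | hyp h =>
    obtain ⟨Γ, hΓ, h⟩ := h
    exact ⟨Γ, hΓ, .hyp h⟩
  | thm h =>
    obtain ⟨Γ, hΓ⟩ := hne
    exact ⟨Γ, hΓ, .thm h⟩
  | mp _ _ ih₁ ih₂ =>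
    obtain ⟨Γ, hΓ, d₁⟩ := ih₁
    obtain ⟨Δ, hΔ, d₂⟩ := ih₂
    rcases hc.total hΓ hΔ with h | h
    · exact ⟨Δ, hΔ, .mp (d₁.mono h) d₂⟩
    · exact ⟨Γ, hΓ, .mp d₁ (d₂.mono h)⟩

end Calculus

/-- Maximal consistent sets of formulas in `k` variables. -/
structure World (T : lang.Theory) (k : ℕ) where
  carrier : Set (Fm k)
  thm {φ : Fm k} : Provable T φ → φ ∈ carrier
  mp {φ ψ : Fm k} : φ.imp ψ ∈ carrier → φ ∈ carrier → ψ ∈ carrier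
  bot : ⊥ ∉ carrier
  em (φ : Fm k) : φ ∈ carrier ∨ φ.not ∈ carrier

instance {T : lang.Theory} {k : ℕ} : Membership (Fm k) (World T k) := ⟨fun w φ => φ ∈ w.carrier⟩

/-- Lindenbaum's lemma: derivations are finitary, so Zorn's lemma yields a maximal consistent
extension, and maximality makes it deductively closed and complete. -/
theorem exists_world {T : lang.Theory} {k : ℕ} {Γ : Set (Fm k)} (h : ¬ Der T Γ ⊥) :
    ∃ w : World T k, ∀ φ ∈ Γ, φ ∈ w := by
  obtain ⟨w, hΓ, hw⟩ := zorn_subset_nonempty {Δ : Set (Fm k) | ¬ Der T Δ ⊥}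
    (fun c hc hch hne => ⟨⋃₀ c, fun d => by
        obtain ⟨Δ, hΔ, d⟩ := d.of_sUnion hch hne
        exact hc hΔ d, fun s hs => Set.subset_sUnion_of_mem hs⟩) Γ h
  have hcl : ∀ φ, Der T w φ → φ ∈ w := by
    intro φ d
    refine hw.2 (y := insert φ w) (fun d' => hw.1 (.mp d'.imp_intro d)) (Set.subset_insert _ _)
      (Set.mem_insert _ _)
  refine ⟨⟨w, fun h => hcl _ (.thm h), fun h₁ h₂ => hcl _ (.mp (.hyp h₁) (.hyp h₂)),
    fun h => hw.1 (.hyp h), fun φ => ?_⟩, hΓ⟩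
  by_contra! hφ
  refine hφ.2 (hcl _ (Der.imp_intro ?_))
  by_contra hcon
  exact hφ.1 (hw.2 (y := insert φ w) hcon (Set.subset_insert _ _) (Set.mem_insert _ _))

namespace World

variable {T : lang.Theory} {k : ℕ} (w : World T k)

theorem mem_of_der {φ : Fm k} (d : Der T w.carrier φ) : φ ∈ w := by
  induction d with
  | hyp h => exact h
  | thm h => exact w.thm h
  | mp _ _ ih₁ ih₂ => exact w.mp ih₁ ih₂

theorem not_mem_iff {φ : Fm k} : φ.not ∈ w ↔ φ ∉ w :=
  ⟨fun h h' => w.bot (w.mp h h'), fun h => (w.em φ).resolve_left h⟩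

theorem imp_mem_iff {φ ψ : Fm k} : φ.imp ψ ∈ w ↔ (φ ∈ w → ψ ∈ w) := by
  refine ⟨fun h => w.mp h, fun h => ?_⟩
  by_cases hφ : φ ∈ w
  · exact w.mp (w.thm (.impK _ _)) (h hφ)
  · refine w.mem_of_der (Der.imp_intro (.mp (.thm (provable_efq ψ)) (.mp (φ := φ) ?_ ?_)))
    · exact .hyp (Or.inr (w.not_mem_iff.2 hφ))
    · exact .hyp (Or.inl rfl)

theorem inst_mem {φ : Fm (k + 1)} (h : φ.all ∈ w) (t : Tm k) : inst φ t ∈ w :=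
  w.mp (w.thm (.allElim φ t)) h

/-- If `φ.not` were inconsistent with the lifts of `w`, then `φ` would follow from formulas that do
not contain the last variable, and `φ.all` would follow from `w`. The new variable is thus the
Henkin constant. -/
theorem exists_extension {φ : Fm (k + 1)} (h : φ.all ∉ w) :
    ∃ w' : World T (k + 1), (∀ χ ∈ w, lift χ ∈ w') ∧ φ ∉ w' := by
  obtain ⟨w', hw'⟩ := exists_world (T := T) (Γ := insert φ.not (lift '' w.carrier)) fun d =>
    h (w.mem_of_der (Der.all_intro (.mp (.thm (.dne φ)) d.imp_intro)))
  exact ⟨w', fun χ hχ => hw' _ (Or.inr ⟨χ, hχ, rfl⟩), w'.not_mem_iff.1 (hw' _ (Or.inl rfl))⟩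

theorem exists_extension_of_imp (φ : Fm (k + 1)) :
    ∃ w' : World T (k + 1), (∀ χ ∈ w, lift χ ∈ w') ∧ (φ.all ∉ w → φ ∉ w') := by
  by_cases h : φ.all ∈ w
  -- No counterexample is wanted here, and any extension will do. One exists because `∀ ⊥`,
  -- instantiated at `zero`, would put `⊥` into `w`.
  · obtain ⟨w', h', -⟩ := w.exists_extension (φ := ⊥) fun hb => w.bot (w.inst_mem hb zero)
    exact ⟨w', h', fun h' => absurd h h'⟩
  · obtain ⟨w', h', h''⟩ := w.exists_extension h
    exact ⟨w', h', fun _ => h''⟩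

theorem eq_refl (t : Tm k) : eq t t ∈ w := w.thm (.eqRefl t)

theorem eq_subst {t u : Tm k} (h : eq t u ∈ w) (φ : Fm (k + 1)) (hφ : inst φ t ∈ w) :
    inst φ u ∈ w := w.mp (w.mp (w.thm (.eqSubst t u φ)) h) hφ

theorem eq_symm {t u : Tm k} (h : eq t u ∈ w) : eq u t ∈ w := by
  have := w.eq_subst h (eq (v (Fin.last k)) (liftTm t))
  simp only [inst, subst_eq, substTm_var, Fin.snoc_last, substTm_snoc_liftTm, substTm_id] at this
  exact this (w.eq_refl t)

theorem eq_trans {t u r : Tm k} (h : eq t u ∈ w) (h' : eq u r ∈ w) : eq t r ∈ w := by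
  have := w.eq_subst h' (eq (liftTm t) (v (Fin.last k)))
  simp only [inst, subst_eq, substTm_var, Fin.snoc_last, substTm_snoc_liftTm, substTm_id] at this
  exact this h

theorem eq_succ {t u : Tm k} (h : eq t u ∈ w) : eq (succ t) (succ u) ∈ w := by
  have := w.eq_subst h (eq (succ (liftTm t)) (succ (v (Fin.last k))))
  simp only [inst, subst_eq, substTm_succ, substTm_var, Fin.snoc_last, substTm_snoc_liftTm,
    substTm_id] at this
  exact this (w.eq_refl _)

theorem eq_add {t u t' u' : Tm k} (h : eq t t' ∈ w) (h' : eq u u' ∈ w) :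
    eq (add t u) (add t' u') ∈ w := by
  have h₁ := w.eq_subst h (eq (add (liftTm t) (liftTm u)) (add (v (Fin.last k)) (liftTm u)))
  have h₂ := w.eq_subst h' (eq (add (liftTm t') (liftTm u)) (add (liftTm t') (v (Fin.last k))))
  simp only [inst, subst_eq, substTm_add, substTm_var, Fin.snoc_last, substTm_snoc_liftTm,
    substTm_id] at h₁ h₂
  exact w.eq_trans (h₁ (w.eq_refl _)) (h₂ (w.eq_refl _))

theorem eq_mul {t u t' u' : Tm k} (h : eq t t' ∈ w) (h' : eq u u' ∈ w) :
    eq (mul t u) (mul t' u') ∈ w := by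
  have h₁ := w.eq_subst h (eq (mul (liftTm t) (liftTm u)) (mul (v (Fin.last k)) (liftTm u)))
  have h₂ := w.eq_subst h' (eq (mul (liftTm t') (liftTm u)) (mul (liftTm t') (v (Fin.last k))))
  simp only [inst, subst_eq, substTm_mul, substTm_var, Fin.snoc_last, substTm_snoc_liftTm,
    substTm_id] at h₁ h₂
  exact w.eq_trans (h₁ (w.eq_refl _)) (h₂ (w.eq_refl _))

theorem le_congr {t u t' u' : Tm k} (h : eq t t' ∈ w) (h' : eq u u' ∈ w) (hl : le t u ∈ w) :
    le t' u' ∈ w := by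
  have h₁ := w.eq_subst h (le (v (Fin.last k)) (liftTm u))
  have h₂ := w.eq_subst h' (le (liftTm t') (v (Fin.last k)))
  simp only [inst, subst_le, substTm_var, Fin.snoc_last, substTm_snoc_liftTm,
    substTm_id] at h₁ h₂
  exact h₂ (h₁ hl)

end World

/-! ### Henkin chains and the term model -/

/-- A formula in `j` variables, seen as a formula in `k ≥ j` variables. -/
def up {j k : ℕ} (h : j ≤ k) (φ : Fm j) : Fm k := subst φ fun i => v (i.castLE h)

/-- A term in `j` variables, seen as a term in `k ≥ j` variables. -/
def upTm {j k : ℕ} (h : j ≤ k) (t : Tm j) : Tm k := substTm (fun i => v (i.castLE h)) t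

theorem up_refl {k : ℕ} (φ : Fm k) : up le_rfl φ = φ := subst_id φ

theorem upTm_refl {k : ℕ} (t : Tm k) : upTm le_rfl t = t := substTm_id t

theorem lift_up {j k : ℕ} (h : j ≤ k) (φ : Fm j) :
    lift (up h φ) = up (h.trans (Nat.le_succ k)) φ := by
  rw [lift, up, subst_subst]; rfl

theorem upTm_upTm {j k l : ℕ} (h : j ≤ k) (h' : k ≤ l) (t : Tm j) :
    upTm h' (upTm h t) = upTm (h.trans h') t := by
  rw [upTm, upTm, substTm_substTm]; rfl

/-- Chains of worlds, one for each number of variables, in which each failing universal formula has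
a counterexample. -/
structure Henkin (T : lang.Theory) where
  ofChain ::
  W : ∀ k, World T k
  lift_mem {k : ℕ} {φ : Fm k} : φ ∈ W k → lift φ ∈ W (k + 1)
  exists_witness {k : ℕ} {φ : Fm (k + 1)} : φ.all ∉ W k → ∃ (m : ℕ) (h : k ≤ m),
    subst φ (snocVar fun i : Fin k => v (i.castLE h)) ∉ W (m + 1)

theorem up_mem_of_chain {T : lang.Theory} {W : ∀ k, World T k}
    (hW : ∀ {k : ℕ} {φ : Fm k}, φ ∈ W k → lift φ ∈ W (k + 1)) {j k : ℕ} (h : j ≤ k)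
    {φ : Fm j} : up h φ ∈ W k ↔ φ ∈ W j := by
  have key : ∀ {φ : Fm j}, φ ∈ W j → up h φ ∈ W k := by
    intro φ hφ
    induction k, h using Nat.le_induction with
    | base => rwa [up_refl]
    | succ k h ih => rw [← lift_up h]; exact hW ih
  refine ⟨fun h' => ?_, key⟩
  by_contra hφ
  exact (W k).not_mem_iff.1 (key ((W j).not_mem_iff.2 hφ)) h'

instance : Countable (Σ j, Fm (j + 1)) := by
  refine Function.Injective.countable (f := fun p : Σ j, Fm (j + 1) => Nat.pair p.1 (code p.2)) ?_
  rintro ⟨j, φ⟩ ⟨j', φ'⟩ h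
  obtain ⟨h₁, h⟩ := Nat.pair_eq_pair.1 h
  obtain rfl : j = j' := h₁
  rw [code_injective (show code φ = code φ' from h)]

/-- Bookkeeping: stage `k` treats the formula numbered `k.unpair.1`. Every formula is thus treated
infinitely often, in particular once enough variables are present; until then the task is the dummy
`⊥`. -/
theorem exists_henkin {T : lang.Theory} (w : World T 0) : ∃ H : Henkin T, H.W 0 = w := by
  classical
  have : Nonempty (Σ j, Fm (j + 1)) := ⟨⟨0, ⊥⟩⟩
  obtain ⟨f, hf⟩ := exists_surjective_nat (Σ j, Fm (j + 1))
  let task : ∀ k, Fm (k + 1) := fun k =>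
    if h : (f k.unpair.1).1 ≤ k then
      subst (f k.unpair.1).2 (snocVar fun i : Fin (f k.unpair.1).1 => v (i.castLE h))
    else ⊥
  choose next hnext using fun k (w : World T k) => w.exists_extension_of_imp (task k)
  let W : ∀ k, World T k := fun k => Nat.rec w next k
  have hW : ∀ {k : ℕ} {φ : Fm k}, φ ∈ W k → lift φ ∈ W (k + 1) :=
    fun {k φ} h => (hnext k (W k)).1 φ h
  refine ⟨⟨W, hW, fun {k φ} hφ => ?_⟩, rfl⟩
  obtain ⟨a, ha⟩ := hf ⟨k, φ⟩
  -- Stage `Nat.pair a k` treats formula number `a`, and its index is at least `k`, so the formula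
  -- can be read there.
  have hk : k ≤ Nat.pair a k := Nat.right_le_pair a k
  have ht : task (Nat.pair a k) = subst φ (snocVar fun i : Fin k => v (i.castLE hk)) := by
    have : (f (Nat.pair a k).unpair.1) = ⟨k, φ⟩ := by rw [Nat.unpair_pair]; exact ha
    simp only [task]
    generalize f (Nat.pair a k).unpair.1 = p at this
    subst this
    rw [dif_pos hk]
  refine ⟨_, hk, ?_⟩
  rw [← ht]
  refine (hnext _ (W _)).2 ?_
  rw [ht]
  exact fun h => hφ ((up_mem_of_chain hW hk).1 h)

namespace Henkin

variable {T : lang.Theory} (H : Henkin T)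

theorem up_mem {j k : ℕ} (h : j ≤ k) {φ : Fm j} : up h φ ∈ H.W k ↔ φ ∈ H.W j :=
  up_mem_of_chain H.lift_mem h

theorem eq_up_mem {j k : ℕ} (h : j ≤ k) {t u : Tm j} :
    eq (upTm h t) (upTm h u) ∈ H.W k ↔ eq t u ∈ H.W j := H.up_mem h (φ := eq t u)

theorem le_up_mem {j k : ℕ} (h : j ≤ k) {t u : Tm j} :
    le (upTm h t) (upTm h u) ∈ H.W k ↔ le t u ∈ H.W j := by
  rw [← H.up_mem h, up, subst_le]; rfl

/-- Provable equality of terms, across all numbers of variables. -/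
def termSetoid : Setoid (Σ k, Tm k) where
  r p q := ∃ (m : ℕ) (hp : p.1 ≤ m) (hq : q.1 ≤ m), eq (upTm hp p.2) (upTm hq q.2) ∈ H.W m
  iseqv := by
    refine ⟨fun p => ⟨p.1, le_rfl, le_rfl, World.eq_refl _ _⟩,
      fun ⟨m, hp, hq, h⟩ => ⟨m, hq, hp, World.eq_symm _ h⟩, ?_⟩
    rintro p q r ⟨m, hp, hq, h⟩ ⟨m', hq', hr, h'⟩
    have h₁ := (H.eq_up_mem (le_max_left m m')).2 h
    have h₂ := (H.eq_up_mem (le_max_right m m')).2 h'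
    rw [upTm_upTm, upTm_upTm] at h₁ h₂
    exact ⟨_, _, _, World.eq_trans _ h₁ h₂⟩

/-- The universe of the term model. -/
def Model : Type := Quotient H.termSetoid

/-- The element of the term model named by a term. -/
def mk {k : ℕ} (t : Tm k) : H.Model := Quotient.mk H.termSetoid ⟨k, t⟩

theorem mk_eq_mk {k : ℕ} {t u : Tm k} : H.mk t = H.mk u ↔ eq t u ∈ H.W k := by
  refine ⟨fun h => ?_, fun h => Quotient.sound ⟨k, le_rfl, le_rfl, ?_⟩⟩
  · obtain ⟨m, hp, hq, h⟩ := Quotient.exact h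
    exact (H.eq_up_mem hp).1 h
  · rwa [upTm_refl, upTm_refl]

theorem mk_upTm {j k : ℕ} (h : j ≤ k) (t : Tm j) : H.mk (upTm h t) = H.mk t :=
  Quotient.sound ⟨k, le_rfl, h, by rw [upTm_refl]; exact World.eq_refl _ _⟩

theorem exists_mk (a : H.Model) : ∃ (k : ℕ) (t : Tm k), H.mk t = a := by
  obtain ⟨⟨k, t⟩, rfl⟩ := Quotient.exists_rep a
  exact ⟨k, t, rfl⟩

theorem exists_mk_mk (a b : H.Model) : ∃ (k : ℕ) (t u : Tm k), H.mk t = a ∧ H.mk u = b := by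
  obtain ⟨j, t, rfl⟩ := H.exists_mk a
  obtain ⟨k, u, rfl⟩ := H.exists_mk b
  exact ⟨max j k, upTm (le_max_left _ _) t, upTm (le_max_right _ _) u, H.mk_upTm _ _,
    H.mk_upTm _ _⟩

theorem exists_op (F : ∀ k, Tm k → Tm k → Tm k) (a b : H.Model) :
    ∃ (c : H.Model) (k : ℕ) (t u : Tm k), H.mk t = a ∧ H.mk u = b ∧ H.mk (F k t u) = c := by
  obtain ⟨k, t, u, h⟩ := H.exists_mk_mk a b
  exact ⟨_, k, t, u, h.1, h.2, rfl⟩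

/-- The operation on the term model that a binary operation on terms induces. -/
noncomputable def op (F : ∀ k, Tm k → Tm k → Tm k) (a b : H.Model) : H.Model :=
  (H.exists_op F a b).choose

theorem exists_common {j k : ℕ} {t : Tm j} {u : Tm k} (h : H.mk t = H.mk u) :
    ∀ {m : ℕ} (hj : j ≤ m) (hk : k ≤ m), eq (upTm hj t) (upTm hk u) ∈ H.W m := by
  intro m hj hk
  rw [← H.mk_eq_mk, H.mk_upTm, H.mk_upTm, h]

/-- The chosen representatives and the given ones become equal once all are raised to `max j k`
variables, where the congruence `hF'` applies. -/
theorem op_mk {F : ∀ k, Tm k → Tm k → Tm k}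
    (hF : ∀ {j k : ℕ} (h : j ≤ k) (t u : Tm j), upTm h (F j t u) = F k (upTm h t) (upTm h u))
    (hF' : ∀ {k : ℕ} (w : World T k) {t u t' u' : Tm k}, eq t t' ∈ w → eq u u' ∈ w →
      eq (F k t u) (F k t' u') ∈ w) {k : ℕ} (t u : Tm k) :
    H.op F (H.mk t) (H.mk u) = H.mk (F k t u) := by
  obtain ⟨j, t', u', ht, hu, h⟩ := (H.exists_op F (H.mk t) (H.mk u)).choose_spec
  refine h.symm.trans ?_
  rw [← H.mk_upTm (le_max_left j k), ← H.mk_upTm (le_max_right j k) (F k t u), hF, hF,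
    H.mk_eq_mk]
  exact hF' _ (H.exists_common ht _ _) (H.exists_common hu _ _)

noncomputable instance : lang.Structure H.Model where
  funMap {_} f x :=
    match f with
    | Func.zero => H.mk (zero : Tm 0)
    -- The successor is treated as a binary operation that ignores its second argument, so that `op`
    -- serves for all three function symbols.
    | Func.succ => H.op (fun _ t _ => succ t) (x 0) (x 0)
    | Func.add => H.op (fun _ t u => add t u) (x 0) (x 1)
    | Func.mul => H.op (fun _ t u => mul t u) (x 0) (x 1)
  RelMap {_} r x :=
    match r with
    | Rel.le => ∃ (k : ℕ) (t u : Tm k), H.mk t = x 0 ∧ H.mk u = x 1 ∧ le t u ∈ H.W k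

instance : Nonempty H.Model := ⟨H.mk (zero : Tm 0)⟩

theorem val_mk {k m : ℕ} (t : Tm k) (σ : Fin k → Tm m) :
    val t (fun i => H.mk (σ i)) = H.mk (substTm σ t) := by
  induction t with
  | var x => rcases x with e | i; exacts [e.elim, rfl]
  | func f ts ih =>
    cases f with
    | zero =>
      refine (H.mk_upTm (Nat.zero_le m) zero).symm.trans ?_
      rw [show ts = ![] from Subsingleton.elim _ _]
      exact congrArg H.mk ((substTm_zero _).trans (substTm_zero _).symm)
    | succ =>
      change H.op (fun _ t _ => succ t) (val (ts 0) _) (val (ts 0) _) = _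
      rw [ih 0, H.op_mk (F := fun _ t _ => succ t) (fun _ _ _ => substTm_succ _ _) (fun w _ _ _ _ h _ => w.eq_succ h),
        ← substTm_succ]
      refine congrArg (fun x => H.mk (substTm σ x)) ?_
      unfold succ
      congr 1
      funext i
      fin_cases i
      rfl
    | add =>
      change H.op (fun _ t u => add t u) (val (ts 0) _) (val (ts 1) _) = _
      rw [ih 0, ih 1, H.op_mk (F := fun _ t u => add t u)
          (fun _ _ _ => substTm_add _ _ _) (fun w _ _ _ _ h h' => w.eq_add h h'),
        ← substTm_add]
      refine congrArg (fun x => H.mk (substTm σ x)) ?_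
      unfold add
      congr 1
      funext i
      fin_cases i <;> rfl
    | mul =>
      change H.op (fun _ t u => mul t u) (val (ts 0) _) (val (ts 1) _) = _
      rw [ih 0, ih 1, H.op_mk (F := fun _ t u => mul t u)
          (fun _ _ _ => substTm_mul _ _ _) (fun w _ _ _ _ h h' => w.eq_mul h h'),
        ← substTm_mul]
      refine congrArg (fun x => H.mk (substTm σ x)) ?_
      unfold mul
      congr 1
      funext i
      fin_cases i <;> rfl

theorem relMap_le_mk {k : ℕ} (t u : Tm k) :
    FirstOrder.Language.Structure.RelMap (L := lang) (n := 2) Rel.le ![H.mk t, H.mk u] ↔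
      le t u ∈ H.W k := by
  refine ⟨?_, fun h => ⟨k, t, u, rfl, rfl, h⟩⟩
  rintro ⟨j, t', u', ht, hu, h⟩
  refine (H.le_up_mem (le_max_right j k)).1 ?_
  exact World.le_congr _ (H.exists_common ht _ _) (H.exists_common hu _ _)
    ((H.le_up_mem (le_max_left j k)).2 h)

/-- Truth lemma. A universal formula outside the world fails at a variable supplied by
`exists_witness`. Conversely, each element is named by a term, perhaps in more variables, and a
universal formula in the world can be raised to that many variables and instantiated. -/
theorem sat_mk {k : ℕ} (φ : Fm k) {m : ℕ} (σ : Fin k → Tm m) :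
    Sat φ (fun i => H.mk (σ i)) ↔ subst φ σ ∈ H.W m := by
  induction φ generalizing m with
  | falsum => exact ⟨False.elim, (H.W m).bot⟩
  | equal t u => rw [sat_equal, val_mk, val_mk, mk_eq_mk]; rfl
  | rel R ts =>
    cases R
    have : (FirstOrder.Language.BoundedFormula.rel (L := lang) (l := 2) Rel.le ts : Fm _) =
        le (ts 0) (ts 1) := by
      unfold le
      congr 1
      funext i
      fin_cases i <;> rfl
    rw [this, subst_le, ← relMap_le_mk, ← val_mk, ← val_mk]
    unfold le
    change FirstOrder.Language.Structure.RelMap (L := lang) (n := 2) Rel.le (fun i => val _ _) ↔ _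
    refine iff_of_eq (congrArg _ ?_)
    funext i
    fin_cases i <;> rfl
  | imp φ ψ ih₁ ih₂ => rw [sat_imp, ih₁, ih₂, ← World.imp_mem_iff]; rfl
  | @all n φ ih =>
    have key : ∀ {m : ℕ} (σ : Fin n → Tm m) (t : Tm m),
        Sat φ (Fin.snoc (α := fun _ => H.Model) (fun i => H.mk (σ i)) (H.mk t)) ↔
          subst φ (Fin.snoc (α := fun _ => Tm m) σ t) ∈ H.W m := by
      intro m σ t
      rw [← ih]
      refine iff_of_eq (congrArg _ ?_)
      funext i
      refine Fin.lastCases ?_ (fun i => ?_) i <;> simp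
    have hup : ∀ {m l : ℕ} (h : m ≤ l) (σ : Fin n → Tm m),
        (fun i => H.mk (σ i)) = fun i => H.mk (upTm h (σ i)) :=
      fun h σ => funext fun i => (H.mk_upTm h (σ i)).symm
    rw [sat_all]
    constructor
    · intro h
      by_contra hn
      obtain ⟨l, hl, hw⟩ := H.exists_witness (φ := subst φ (snocVar σ)) hn
      refine hw ?_
      rw [subst_subst]
      have := h (H.mk (v (Fin.last l)))
      rw [hup (hl.trans (Nat.le_succ l)), key] at this
      convert this using 2
      funext i
      rw [snocVar_comp]
      refine Fin.lastCases ?_ (fun i => ?_) i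
      · simp [snocVar]
      · simp only [snocVar, Fin.snoc_castSucc, liftTm_eq_substTm, upTm, substTm_substTm]
        rfl
    · intro h a
      obtain ⟨j, t, rfl⟩ := H.exists_mk a
      have h' := (H.up_mem (le_max_left m j)).2 h
      rw [up, subst_subst] at h'
      have h'' := (H.W (max m j)).inst_mem h' (upTm (le_max_right m j) t)
      rw [hup (le_max_left m j), ← H.mk_upTm (le_max_right m j), key]
      rwa [inst_subst_snocVar] at h''

end Henkin

/-- Gödel's completeness theorem. -/
theorem proves_of_models {T : lang.Theory} {φ : lang.Sentence}
    (h : ∀ (M : Type) [lang.Structure M] [Nonempty M], M ⊨ T → M ⊨ φ) : Proves T φ := by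
  by_contra hφ
  have hcons : ¬ Der T {FirstOrder.Language.BoundedFormula.not (n := 0) φ} ⊥ := fun d =>
    hφ (.mp (.dne _) (Der.provable (Der.imp_intro (by simpa using d))))
  obtain ⟨w, hw⟩ := exists_world hcons
  obtain ⟨H, rfl⟩ := exists_henkin w
  have key : ∀ ψ : lang.Sentence, H.Model ⊨ ψ ↔ ψ ∈ (H.W 0) := by
    intro ψ
    rw [models_iff_sat ψ (fun i => H.mk (v (k := 0) i)), H.sat_mk, subst_id]
  refine (H.W 0).not_mem_iff.1 (hw _ rfl) ((key φ).1 (h H.Model ⟨fun ψ hψ => (key ψ).2 ?_⟩))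
  have := (H.W 0).thm (.ax (k := 0) hψ)
  rwa [ofSentence_zero] at this

theorem exists_model_of_consistent {T : lang.Theory} (h : Consistent T) :
    ∃ (M : Type) (_ : lang.Structure M) (_ : Nonempty M), M ⊨ T := by
  by_contra! hM
  exact h (proves_of_models fun M _ _ hT => absurd hT (hM M _ ‹_›))

/-! ## Numerals in models of Robinson's arithmetic -/

section Operations

variable {M : Type*} [lang.Structure M]

/-- Zero of a structure. -/
def mzero (M : Type*) [lang.Structure M] : M :=
  FirstOrder.Language.Structure.funMap (L := lang) (n := 0) Func.zero ![]

/-- Successor in a structure. -/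
def msucc (a : M) : M := FirstOrder.Language.Structure.funMap (L := lang) (n := 1) Func.succ ![a]

/-- Addition in a structure. -/
def madd (a b : M) : M :=
  FirstOrder.Language.Structure.funMap (L := lang) (n := 2) Func.add ![a, b]

/-- Multiplication in a structure. -/
def mmul (a b : M) : M :=
  FirstOrder.Language.Structure.funMap (L := lang) (n := 2) Func.mul ![a, b]

/-- The order of a structure. -/
def mle (a b : M) : Prop :=
  FirstOrder.Language.Structure.RelMap (L := lang) (n := 2) Rel.le ![a, b]

theorem val_func_zero {k : ℕ} (ts : Fin 0 → Tm k) (x : Fin k → M) :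
    val (FirstOrder.Language.Term.func (L := lang) (l := 0) Func.zero ts) x = mzero M :=
  congrArg (FirstOrder.Language.Structure.funMap _) (Subsingleton.elim _ _)

theorem val_func_succ {k : ℕ} (ts : Fin 1 → Tm k) (x : Fin k → M) :
    val (FirstOrder.Language.Term.func (L := lang) (l := 1) Func.succ ts) x =
      msucc (val (ts 0) x) := by
  refine congrArg (FirstOrder.Language.Structure.funMap _) (funext fun i => ?_)
  fin_cases i
  rfl

theorem val_func_add {k : ℕ} (ts : Fin 2 → Tm k) (x : Fin k → M) :
    val (FirstOrder.Language.Term.func (L := lang) (l := 2) Func.add ts) x =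
      madd (val (ts 0) x) (val (ts 1) x) := by
  refine congrArg (FirstOrder.Language.Structure.funMap _) (funext fun i => ?_)
  fin_cases i <;> rfl

theorem val_func_mul {k : ℕ} (ts : Fin 2 → Tm k) (x : Fin k → M) :
    val (FirstOrder.Language.Term.func (L := lang) (l := 2) Func.mul ts) x =
      mmul (val (ts 0) x) (val (ts 1) x) := by
  refine congrArg (FirstOrder.Language.Structure.funMap _) (funext fun i => ?_)
  fin_cases i <;> rfl

@[simp] theorem val_zero {k : ℕ} (x : Fin k → M) : val zero x = mzero M := val_func_zero _ x

@[simp] theorem val_succ {k : ℕ} (t : Tm k) (x : Fin k → M) :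
    val (succ t) x = msucc (val t x) := val_func_succ _ x

@[simp] theorem val_add {k : ℕ} (t u : Tm k) (x : Fin k → M) :
    val (add t u) x = madd (val t x) (val u x) := val_func_add _ x

@[simp] theorem val_mul {k : ℕ} (t u : Tm k) (x : Fin k → M) :
    val (mul t u) x = mmul (val t x) (val u x) := val_func_mul _ x

@[simp] theorem sat_le {k : ℕ} (t u : Tm k) (x : Fin k → M) :
    Sat (le t u) x ↔ mle (val t x) (val u x) := by
  refine iff_of_eq (congrArg (FirstOrder.Language.Structure.RelMap _) (funext fun i => ?_))
  fin_cases i <;> rfl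

@[simp] theorem sat_ballLE {k : ℕ} (t : Tm k) (φ : Fm (k + 1)) (x : Fin k → M) :
    Sat (ballLE t φ) x ↔ ∀ a : M, mle a (val t x) → Sat φ (Fin.snoc (α := fun _ => M) x a) := by
  simp [ballLE]

@[simp] theorem sat_bexLE {k : ℕ} (t : Tm k) (φ : Fm (k + 1)) (x : Fin k → M) :
    Sat (bexLE t φ) x ↔ ∃ a : M, mle a (val t x) ∧ Sat φ (Fin.snoc (α := fun _ => M) x a) := by
  simp [bexLE]

/-- The axioms of Robinson's arithmetic, read in a structure. -/
structure QModel (M : Type*) [lang.Structure M] : Prop where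
  succ_ne_zero (a : M) : msucc a ≠ mzero M
  succ_inj (a b : M) : msucc a = msucc b → a = b
  eq_zero_or_succ (a : M) : a ≠ mzero M → ∃ b, a = msucc b
  add_zero (a : M) : madd a (mzero M) = a
  add_succ (a b : M) : madd a (msucc b) = msucc (madd a b)
  mul_zero (a : M) : mmul a (mzero M) = mzero M
  mul_succ (a b : M) : mmul a (msucc b) = madd (mmul a b) a
  le_iff (a b : M) : mle a b ↔ ∃ c, madd c a = b

theorem models_Q_iff : M ⊨ Q ↔ QModel M := by
  have h₀ : ∀ a : M, (Fin.snoc (α := fun _ => M) (Fin.elim0 : Fin 0 → M) a : Fin 1 → M) = ![a] :=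
    fun a => funext fun i => by fin_cases i; rfl
  have h₁ : ∀ a b : M, (Fin.snoc (α := fun _ => M) ![a] b : Fin 2 → M) = ![a, b] :=
    fun a b => funext fun i => by fin_cases i <;> rfl
  have h₂ : ∀ a b c : M, (Fin.snoc (α := fun _ => M) ![a, b] c : Fin 3 → M) = ![a, b, c] :=
    fun a b c => funext fun i => by fin_cases i <;> rfl
  rw [FirstOrder.Language.Theory.model_iff]
  simp only [Q, Set.mem_insert_iff, Set.mem_singleton_iff, forall_eq_or_imp, forall_eq]
  simp only [models_iff_sat _ (Fin.elim0 : Fin 0 → M), sat_all, sat_not, sat_imp, sat_eq, val_succ,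
    val_var, val_zero, val_add, val_mul, sat_ex, sat_iff, sat_le, h₀, h₁, h₂]
  refine ⟨fun ⟨a, b, c, d, e, f, g, h⟩ => ⟨a, b, c, d, e, f, g, h⟩, fun h => ?_⟩
  exact ⟨h.succ_ne_zero, h.succ_inj, h.eq_zero_or_succ, h.add_zero, h.add_succ, h.mul_zero,
    h.mul_succ, h.le_iff⟩

end Operations

@[simp] theorem mzero_nat : mzero ℕ = 0 := rfl
@[simp] theorem msucc_nat (a : ℕ) : msucc a = a + 1 := rfl
@[simp] theorem madd_nat (a b : ℕ) : madd a b = a + b := rfl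
@[simp] theorem mmul_nat (a b : ℕ) : mmul a b = a * b := rfl
@[simp] theorem mle_nat (a b : ℕ) : mle a b ↔ a ≤ b := Iff.rfl

theorem nat_models_Q : ℕ ⊨ Q :=
  models_Q_iff.2
    { succ_ne_zero := fun a => Nat.succ_ne_zero a
      succ_inj := fun _ _ h => Nat.succ_injective h
      eq_zero_or_succ := fun _ h => Nat.exists_eq_succ_of_ne_zero h
      add_zero := fun _ => rfl
      add_succ := fun _ _ => rfl
      mul_zero := fun _ => rfl
      mul_succ := fun _ _ => rfl
      le_iff := fun a b => ⟨fun h => ⟨b - a, Nat.sub_add_cancel h⟩,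
        fun ⟨c, h⟩ => (Nat.le_add_left a c).trans h.le⟩ }

/-- The numeral of a natural number. -/
def num {k : ℕ} : ℕ → Tm k
  | 0 => zero
  | m + 1 => succ (num m)

/-- The value of a numeral in a structure. -/
def mnum (M : Type*) [lang.Structure M] : ℕ → M
  | 0 => mzero M
  | m + 1 => msucc (mnum M m)

@[simp] theorem val_num {M : Type*} [lang.Structure M] {k : ℕ} (m : ℕ) (x : Fin k → M) :
    val (num m) x = mnum M m := by
  induction m with
  | zero => exact val_zero x
  | succ m ih => rw [num, val_succ, ih]; rfl

@[simp] theorem mnum_nat (m : ℕ) : mnum ℕ m = m := by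
  induction m with
  | zero => rfl
  | succ m ih => rw [mnum, ih]; rfl

theorem sat_snoc_mnum {M : Type*} [lang.Structure M] {k : ℕ} (φ : Fm (k + 1)) (x : Fin k → ℕ) (a : ℕ) :
    Sat φ (Fin.snoc (α := fun _ => M) (fun i => mnum M (x i)) (mnum M a)) ↔
      Sat φ (fun i => mnum M ((Fin.snoc (α := fun _ => ℕ) x a : Fin (k + 1) → ℕ) i)) := by
  refine iff_of_eq (congrArg _ (funext fun i => ?_))
  refine Fin.lastCases ?_ (fun i => ?_) i <;> simp

namespace QModel

variable {M : Type*} [lang.Structure M] (hM : QModel M)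
include hM

theorem madd_mnum (i j : ℕ) : madd (mnum M i) (mnum M j) = mnum M (i + j) := by
  induction j with
  | zero => exact hM.add_zero _
  | succ j ih => rw [mnum, hM.add_succ, ih]; rfl

theorem mmul_mnum (i j : ℕ) : mmul (mnum M i) (mnum M j) = mnum M (i * j) := by
  induction j with
  | zero => exact hM.mul_zero _
  | succ j ih => rw [mnum, hM.mul_succ, ih, hM.madd_mnum]; rfl

theorem mnum_injective : Function.Injective (mnum M) := by
  intro i
  induction i with
  | zero =>
    intro j h
    cases j with
    | zero => rfl
    | succ j => exact absurd h.symm (hM.succ_ne_zero _)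
  | succ i ih =>
    intro j h
    cases j with
    | zero => exact absurd h (hM.succ_ne_zero _)
    | succ j => rw [ih (hM.succ_inj _ _ h)]

/-- A model of `Q` need not satisfy induction, so the induction is on the standard number `m`: from
`c + a = m` with `a` a successor, one successor is stripped from both sides. -/
theorem exists_eq_mnum {a : M} {m : ℕ} (h : mle a (mnum M m)) : ∃ i ≤ m, a = mnum M i := by
  obtain ⟨c, h⟩ := (hM.le_iff _ _).1 h
  induction m generalizing a with
  | zero =>
    by_cases ha : a = mzero M
    · exact ⟨0, le_rfl, ha⟩
    · obtain ⟨b, rfl⟩ := hM.eq_zero_or_succ a ha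
      rw [hM.add_succ] at h
      exact absurd h (hM.succ_ne_zero _)
  | succ m ih =>
    by_cases ha : a = mzero M
    · exact ⟨0, Nat.zero_le _, ha⟩
    · obtain ⟨b, rfl⟩ := hM.eq_zero_or_succ a ha
      rw [hM.add_succ] at h
      have h' := hM.succ_inj _ _ h
      obtain ⟨i, hi, rfl⟩ := ih ((hM.le_iff _ _).2 ⟨c, h'⟩) h'
      exact ⟨i + 1, Nat.succ_le_succ hi, rfl⟩

theorem mle_mnum {i j : ℕ} : mle (mnum M i) (mnum M j) ↔ i ≤ j := by
  constructor
  · intro h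
    obtain ⟨i', hi', h⟩ := hM.exists_eq_mnum h
    rwa [hM.mnum_injective h]
  · intro h
    refine (hM.le_iff _ _).2 ⟨mnum M (j - i), ?_⟩
    rw [hM.madd_mnum, Nat.sub_add_cancel h]

/-- Addition in a model of `Q` recurs on the right argument only, so moving a successor across takes
an induction on the standard `m`. -/
theorem succ_madd_mnum (a : M) (m : ℕ) : madd (msucc a) (mnum M m) = madd a (mnum M (m + 1)) := by
  induction m with
  | zero => rw [mnum, hM.add_zero, mnum, hM.add_succ, mnum, hM.add_zero]
  | succ m ih => rw [mnum, hM.add_succ, ih, ← hM.add_succ]; rfl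

/-- This is the comparison that Rosser's argument needs, with `a` possibly nonstandard. If `c + m =
a`, then either `c = 0` and `a` is the numeral `m`, or `c = S d` and `d + S m = a`. -/
theorem mle_mnum_total (a : M) (m : ℕ) : mle a (mnum M m) ∨ mle (mnum M m) a := by
  induction m with
  | zero => exact Or.inr ((hM.le_iff _ _).2 ⟨a, hM.add_zero a⟩)
  | succ m ih =>
    rcases ih with h | h
    · obtain ⟨i, hi, rfl⟩ := hM.exists_eq_mnum h
      exact Or.inl (hM.mle_mnum.2 (hi.trans (Nat.le_succ m)))
    · obtain ⟨c, rfl⟩ := (hM.le_iff _ _).1 h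
      by_cases hc : c = mzero M
      · subst hc
        rw [show mzero M = mnum M 0 from rfl, hM.madd_mnum]
        exact Or.inl (hM.mle_mnum.2 (by omega))
      · obtain ⟨d, rfl⟩ := hM.eq_zero_or_succ c hc
        exact Or.inr ((hM.le_iff _ _).2 ⟨d, (hM.succ_madd_mnum d m).symm⟩)

theorem val_mnum {k : ℕ} (t : Tm k) (x : Fin k → ℕ) :
    val t (fun i => mnum M (x i)) = mnum M (val t x) := by
  induction t with
  | var y => rcases y with e | i; exacts [e.elim, rfl]
  | func f ts ih =>
    cases f with
    | zero => rw [val_func_zero, val_func_zero]; rfl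
    | succ => rw [val_func_succ, val_func_succ, ih]; rfl
    | add => rw [val_func_add, val_func_add, ih, ih, hM.madd_mnum]; rfl
    | mul => rw [val_func_mul, val_func_mul, ih, ih, hM.mmul_mnum]; rfl

end QModel

/-! ### Transfer between `ℕ` and models of `Q` -/

/-- The sentence obtained from a formula by putting numerals for its variables. -/
def numInst {k : ℕ} (φ : Fm k) (x : Fin k → ℕ) : lang.Sentence := subst (m := 0) φ fun i => num (x i)

theorem models_numInst {M : Type*} [lang.Structure M] {k : ℕ} (φ : Fm k) (x : Fin k → ℕ) :
    M ⊨ numInst φ x ↔ Sat φ fun i => mnum M (x i) := by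
  rw [models_iff_sat _ Fin.elim0, numInst, sat_subst]
  simp only [val_num]

theorem isTrue_numInst {k : ℕ} (φ : Fm k) (x : Fin k → ℕ) : IsTrue (numInst φ x) ↔ Sat φ x := by
  rw [IsTrue, models_numInst]
  simp only [mnum_nat]

/-- In a model of `Q` and of the true `Π_m`-sentences, `Σ_{m+1}`-formulas are preserved upwards from
`ℕ` and `Π_{m+1}`-formulas downwards; bounded formulas are preserved in every model of `Q`. -/
theorem Hier.transfer {M : Type*} [lang.Structure M] (hM : QModel M) {s : Side} {n k : ℕ}
    {φ : Fm k} (hφ : Hier s n φ) (hn : ∀ m, n = m + 1 → M ⊨ PiTh m) (x : Fin k → ℕ) :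
    (s = .sigma → Sat φ x → Sat φ fun i => mnum M (x i)) ∧
    (s = .pi → Sat φ (fun i => mnum M (x i)) → Sat φ x) := by
  induction hφ with
  | falsum => exact ⟨fun _ h => h, fun _ h => h⟩
  | eq s n t u =>
    simp only [sat_eq, hM.val_mnum]
    exact ⟨fun _ h => congrArg _ h, fun _ h => hM.mnum_injective h⟩
  | le s n t u =>
    simp only [sat_le, hM.val_mnum, hM.mle_mnum]
    exact ⟨fun _ h => h, fun _ h => h⟩
  | @imp s n k φ ψ _ _ ih₁ ih₂ =>
    -- The premise lies on the dual side, so its half of the induction hypothesis points the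
    -- opposite way, as contravariance demands.
    refine ⟨?_, ?_⟩
    · rintro rfl h h'
      exact (ih₂ hn x).1 rfl (h ((ih₁ hn x).2 rfl h'))
    · rintro rfl h h'
      exact (ih₂ hn x).2 rfl (h ((ih₁ hn x).1 rfl h'))
  | @ballLE s n k t φ _ ih =>
    simp only [sat_ballLE, hM.val_mnum]
    refine ⟨?_, ?_⟩
    · rintro hs h a ha
      obtain ⟨i, hi, rfl⟩ := hM.exists_eq_mnum ha
      exact (sat_snoc_mnum φ x i).2 ((ih hn _).1 hs (h i hi))
    · rintro hs h a ha
      exact (ih hn _).2 hs ((sat_snoc_mnum φ x a).1 (h _ (hM.mle_mnum.2 ha)))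
  | @bexLE s n k t φ _ ih =>
    simp only [sat_bexLE, hM.val_mnum]
    refine ⟨?_, ?_⟩
    · rintro hs ⟨a, ha, h⟩
      exact ⟨_, hM.mle_mnum.2 ha, (sat_snoc_mnum φ x a).2 ((ih hn _).1 hs h)⟩
    · rintro hs ⟨a, ha, h⟩
      obtain ⟨i, hi, rfl⟩ := hM.exists_eq_mnum ha
      exact ⟨i, hi, (ih hn _).2 hs ((sat_snoc_mnum φ x i).1 h)⟩
  | @up s n k φ hφ _ =>
    -- Only here are the true `Π_n`-sentences used. With numerals put for the variables, a true
    -- `Π_n`-formula, or the negation of a false `Σ_n`-formula, is one of them.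
    have hT := hn n rfl
    refine ⟨?_, ?_⟩
    · rintro rfl h
      exact (models_numInst φ x).1
        (hT.realize_of_mem _ ⟨hφ.subst _, (isTrue_numInst φ x).2 h⟩)
    · rintro rfl h
      by_contra hx
      have := hT.realize_of_mem (numInst φ.not x)
        ⟨(Hier.not (s := .pi) hφ).subst _, (isTrue_numInst φ.not x).2 hx⟩
      exact (models_numInst φ.not x).1 this h
  | @ex n k φ _ ih =>
    refine ⟨?_, by rintro ⟨⟩⟩
    rintro - h
    obtain ⟨a, h⟩ := (sat_ex _ _).1 h
    exact (sat_ex _ _).2 ⟨_, (sat_snoc_mnum φ x a).2 ((ih hn _).1 rfl h)⟩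
  | @all n k φ _ ih =>
    refine ⟨by rintro ⟨⟩, ?_⟩
    rintro - h a
    exact (ih hn _).2 rfl ((sat_snoc_mnum φ x a).1 (h _))

/-! ## Definability in the standard model -/

/-- The relation `R` is of the form `∃ y, φ(x, y)` with a `Π_n`-formula `φ`. -/
def SDef (n : ℕ) {k : ℕ} (R : (Fin k → ℕ) → Prop) : Prop :=
  ∃ φ : Fm (k + 1), Hier .pi n φ ∧ ∀ x, R x ↔ ∃ y, Sat φ (Fin.snoc (α := fun _ => ℕ) x y)

/-- The graph of the function `f` is of the form `∃ y, φ(x, y)` with a `Π_n`-formula `φ`. -/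
def SFun (n : ℕ) {k : ℕ} (f : (Fin k → ℕ) → ℕ) : Prop :=
  SDef n fun x : Fin (k + 1) → ℕ => x (Fin.last k) = f fun i => x i.castSucc

/-- `SDef` for unary relations. -/
abbrev SDef₁ (n : ℕ) (P : ℕ → Prop) : Prop := SDef n fun x : Fin 1 → ℕ => P (x 0)

/-- `SDef` for binary relations. -/
abbrev SDef₂ (n : ℕ) (P : ℕ → ℕ → Prop) : Prop := SDef n fun x : Fin 2 → ℕ => P (x 0) (x 1)

/-- `SDef` for ternary relations. -/
abbrev SDef₃ (n : ℕ) (P : ℕ → ℕ → ℕ → Prop) : Prop :=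
  SDef n fun x : Fin 3 → ℕ => P (x 0) (x 1) (x 2)

namespace SDef

variable {n k : ℕ}

theorem congr {R R' : (Fin k → ℕ) → Prop} (h : SDef n R) (hR : ∀ x, R' x ↔ R x) : SDef n R' := by
  obtain ⟨φ, hφ, h⟩ := h
  exact ⟨φ, hφ, fun x => (hR x).trans (h x)⟩

/-- Replacing a witness `b` by any bound `y ≥ b` costs only a bounded quantifier. Several witnesses
can then be merged into one common bound without coding pairs. -/
theorem exists_monotone {R : (Fin k → ℕ) → Prop} (h : SDef n R) :
    ∃ φ : Fm (k + 1), Hier .pi n φ ∧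
      (∀ x, R x ↔ ∃ y, Sat φ (Fin.snoc (α := fun _ => ℕ) x y)) ∧
      ∀ x y y', y ≤ y' → Sat φ (Fin.snoc (α := fun _ => ℕ) x y) →
        Sat φ (Fin.snoc (α := fun _ => ℕ) x y') := by
  obtain ⟨φ, hφ, h⟩ := h
  let σ : Fin (k + 1) → Tm (k + 2) := Fin.snoc (α := fun _ => Tm (k + 2))
    (fun i : Fin k => v i.castSucc.castSucc) (v (Fin.last (k + 1)))
  have hσ : ∀ (x : Fin k → ℕ) a b,
      Sat (subst φ σ) (Fin.snoc (α := fun _ => ℕ) (Fin.snoc (α := fun _ => ℕ) x a) b) ↔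
        Sat φ (Fin.snoc (α := fun _ => ℕ) x b) := by
    intro x a b
    rw [sat_subst]
    refine iff_of_eq (congrArg _ (funext fun i => ?_))
    refine Fin.lastCases ?_ (fun i => ?_) i <;> simp [σ]
  have key : ∀ (x : Fin k → ℕ) a, Sat (bexLE (v (Fin.last k)) (subst φ σ))
      (Fin.snoc (α := fun _ => ℕ) x a) ↔ ∃ b ≤ a, Sat φ (Fin.snoc (α := fun _ => ℕ) x b) := by
    intro x a
    simp only [sat_bexLE, hσ, val_var, Fin.snoc_last, mle_nat]
  refine ⟨bexLE (v (Fin.last k)) (subst φ σ), .bexLE _ (hφ.subst σ), fun x => ?_, ?_⟩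
  · simp only [h, key]
    exact ⟨fun ⟨y, hy⟩ => ⟨y, y, le_rfl, hy⟩, fun ⟨_, y, _, hy⟩ => ⟨y, hy⟩⟩
  · intro x y y' hy h'
    rw [key] at h' ⊢
    obtain ⟨b, hb, h'⟩ := h'
    exact ⟨b, hb.trans hy, h'⟩

theorem of_hier {φ : Fm k} (hφ : Hier .pi n φ) {R : (Fin k → ℕ) → Prop}
    (h : ∀ x, R x ↔ Sat φ x) : SDef n R :=
  ⟨lift φ, hφ.subst _, fun x => by simp [h]⟩

theorem of_hier_zero {s : Side} {φ : Fm k} (hφ : Hier s 0 φ) {R : (Fin k → ℕ) → Prop}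
    (h : ∀ x, R x ↔ Sat φ x) : SDef n R := of_hier (hφ.of_zero rfl _ _) h

theorem and {R R' : (Fin k → ℕ) → Prop} (h : SDef n R) (h' : SDef n R') :
    SDef n fun x => R x ∧ R' x := by
  obtain ⟨φ, hφ, h, hm⟩ := h.exists_monotone
  obtain ⟨ψ, hψ, h', hm'⟩ := h'.exists_monotone
  refine ⟨φ ⊓ ψ, hφ.inf hψ, fun x => ?_⟩
  simp only [sat_inf, h, h']
  constructor
  · rintro ⟨⟨y, hy⟩, ⟨z, hz⟩⟩
    exact ⟨max y z, hm _ _ _ (le_max_left _ _) hy, hm' _ _ _ (le_max_right _ _) hz⟩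
  · rintro ⟨y, hy, hz⟩
    exact ⟨⟨y, hy⟩, y, hz⟩

theorem or {R R' : (Fin k → ℕ) → Prop} (h : SDef n R) (h' : SDef n R') :
    SDef n fun x => R x ∨ R' x := by
  obtain ⟨φ, hφ, h⟩ := h
  obtain ⟨ψ, hψ, h'⟩ := h'
  refine ⟨φ ⊔ ψ, hφ.sup hψ, fun x => ?_⟩
  simp only [sat_sup, h, h', exists_or]

theorem reindex {m : ℕ} (g : Fin k → Fin m) {R : (Fin k → ℕ) → Prop} (h : SDef n R) :
    SDef n fun x : Fin m → ℕ => R fun i => x (g i) := by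
  obtain ⟨φ, hφ, h⟩ := h
  refine ⟨subst φ (Fin.snoc (α := fun _ => Tm (m + 1)) (fun i => v (g i).castSucc)
    (v (Fin.last m))), hφ.subst _, fun x => ?_⟩
  simp only [h, sat_subst]
  refine exists_congr fun y => iff_of_eq (congrArg _ (funext fun i => ?_))
  refine Fin.lastCases ?_ (fun i => ?_) i <;> simp

/-- The substitution exchanging the last two variables. -/
def swapVars (k : ℕ) : Fin (k + 2) → Tm (k + 2) :=
  Fin.snoc (α := fun _ => Tm (k + 2)) (Fin.snoc (α := fun _ => Tm (k + 2))
    (fun i : Fin k => v i.castSucc.castSucc) (v (Fin.last (k + 1)))) (v (Fin.last k).castSucc)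

theorem sat_swapVars (φ : Fm (k + 2)) (x : Fin k → ℕ) (a b : ℕ) :
    Sat (subst φ (swapVars k)) (Fin.snoc (α := fun _ => ℕ) (Fin.snoc (α := fun _ => ℕ) x a) b) ↔
    Sat φ (Fin.snoc (α := fun _ => ℕ) (Fin.snoc (α := fun _ => ℕ) x b) a) := by
  rw [sat_subst]
  refine iff_of_eq (congrArg _ (funext fun i => ?_))
  refine Fin.lastCases ?_ (fun i => Fin.lastCases ?_ (fun i => ?_) i) i <;> simp [swapVars]

/-- One number bounds both the quantified `y` and the witness that belongs to it, so two existential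
quantifiers contract to one. -/
theorem ex {R : (Fin k → ℕ) → ℕ → Prop}
    (h : SDef n fun x : Fin (k + 1) → ℕ => R (fun i => x i.castSucc) (x (Fin.last k))) :
    SDef n fun x => ∃ y, R x y := by
  obtain ⟨φ, hφ, h, hm⟩ := h.exists_monotone
  refine ⟨bexLE (v (Fin.last k)) (subst φ (swapVars k)), .bexLE _ (hφ.subst _), fun x => ?_⟩
  simp only [sat_bexLE, sat_swapVars, val_var, Fin.snoc_last, mle_nat]
  have h' : ∀ a, R x a ↔ _ := fun a => by
    simpa only [Fin.snoc_castSucc, Fin.snoc_last] using h (Fin.snoc (α := fun _ => ℕ) x a)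
  simp only [h']
  constructor
  · rintro ⟨a, y, hy⟩
    exact ⟨max y a, a, le_max_right _ _, hm _ _ _ (le_max_left _ _) hy⟩
  · rintro ⟨w, a, -, hy⟩
    exact ⟨a, w, hy⟩

/-- Collection in `ℕ`: the finitely many witnesses have a maximum, which by monotonicity serves for
all of them. -/
theorem ball_var {R : (Fin k → ℕ) → ℕ → Prop} (i : Fin k)
    (h : SDef n fun x : Fin (k + 1) → ℕ => R (fun i => x i.castSucc) (x (Fin.last k))) :
    SDef n fun x => ∀ y ≤ x i, R x y := by
  obtain ⟨φ, hφ, h, hm⟩ := h.exists_monotone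
  refine ⟨ballLE (v i.castSucc) (subst φ (swapVars k)), .ballLE _ (hφ.subst _), fun x => ?_⟩
  simp only [sat_ballLE, sat_swapVars, val_var, Fin.snoc_castSucc, mle_nat]
  have h' : ∀ a, R x a ↔ _ := fun a => by
    simpa only [Fin.snoc_castSucc, Fin.snoc_last] using h (Fin.snoc (α := fun _ => ℕ) x a)
  simp only [h']
  constructor
  · intro H
    choose! f hf using H
    refine ⟨(Finset.range (x i + 1)).sup f, fun a ha => hm _ _ _ ?_ (hf a ha)⟩
    exact Finset.le_sup (Finset.mem_range.2 (Nat.lt_succ_of_le ha))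
  · rintro ⟨y, hy⟩ a ha
    exact ⟨y, hy a ha⟩

theorem comp {P : ℕ → Prop} (hP : SDef₁ n P) {f : (Fin k → ℕ) → ℕ}
    (hf : SFun n f) : SDef n fun x => P (f x) :=
  (ex (R := fun x y => y = f x ∧ P y) (and hf (hP.reindex fun _ => Fin.last k))).congr
    fun x => by simp

theorem comp₂ {P : ℕ → ℕ → Prop} (hP : SDef₂ n P)
    {f g : (Fin k → ℕ) → ℕ} (hf : SFun n f) (hg : SFun n g) : SDef n fun x => P (f x) (g x) := by
  refine (ex (R := fun x y => y = f x ∧ ∃ z, z = g x ∧ P y z) (and hf (ex (and ?_ ?_)))).congr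
    fun x => by simp
  · exact hg.reindex (Fin.snoc (α := fun _ => Fin (k + 2)) (fun i => i.castSucc.castSucc)
      (Fin.last (k + 1))) |>.congr fun x => by simp
  · exact hP.reindex ![(Fin.last k).castSucc, Fin.last (k + 1)]

theorem comp₃ {P : ℕ → ℕ → ℕ → Prop} (hP : SDef₃ n P)
    {f g h : (Fin k → ℕ) → ℕ} (hf : SFun n f) (hg : SFun n g) (hh : SFun n h) :
    SDef n fun x => P (f x) (g x) (h x) := by
  refine (ex (R := fun x y => y = f x ∧ ∃ z, z = g x ∧ ∃ w, w = h x ∧ P y z w)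
    (and hf (ex (and ?_ (ex (and ?_ ?_)))))).congr fun x => by simp
  · exact hg.reindex (Fin.snoc (α := fun _ => Fin (k + 2)) (fun i => i.castSucc.castSucc)
      (Fin.last (k + 1))) |>.congr fun x => by simp
  · exact hh.reindex (Fin.snoc (α := fun _ => Fin (k + 3))
      (fun i => i.castSucc.castSucc.castSucc) (Fin.last (k + 2))) |>.congr fun x => by simp
  · exact hP.reindex ![(Fin.last k).castSucc.castSucc, (Fin.last (k + 1)).castSucc,
      Fin.last (k + 2)]

end SDef

namespace SFun

variable {n k : ℕ}

theorem of_term (t : Tm k) : SFun n fun x => val t x :=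
  SDef.of_hier_zero (Hier.eq .pi 0 (v (Fin.last k)) (liftTm t)) fun x => by simp

theorem var (i : Fin k) : SFun n fun x => x i := of_term (v i)

theorem const (c : ℕ) : SFun n fun _ : Fin k → ℕ => c := by
  simpa using of_term (n := n) (k := k) (num c)

theorem comp₂ {F : ℕ → ℕ → ℕ} (hF : SDef n fun x : Fin 3 → ℕ => x 2 = F (x 0) (x 1))
    {f g : (Fin k → ℕ) → ℕ} (hf : SFun n f) (hg : SFun n g) : SFun n fun x => F (f x) (g x) := by
  refine SDef.comp₃ (P := fun a b c => c = F a b) hF ?_ ?_ (var _)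
  · exact hf.reindex (Fin.snoc (α := fun _ => Fin (k + 2)) (fun i => i.castSucc.castSucc)
      (Fin.last (k + 1))) |>.congr fun x => by simp
  · exact hg.reindex (Fin.snoc (α := fun _ => Fin (k + 2)) (fun i => i.castSucc.castSucc)
      (Fin.last (k + 1))) |>.congr fun x => by simp

theorem add {f g : (Fin k → ℕ) → ℕ} (hf : SFun n f) (hg : SFun n g) :
    SFun n fun x => f x + g x :=
  comp₂ (SDef.of_hier_zero (Hier.eq .pi 0 (v 2) (Arith.add (v 0) (v 1))) fun x => by simp) hf hg

theorem mul {f g : (Fin k → ℕ) → ℕ} (hf : SFun n f) (hg : SFun n g) :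
    SFun n fun x => f x * g x :=
  comp₂ (SDef.of_hier_zero (Hier.eq .pi 0 (v 2) (Arith.mul (v 0) (v 1))) fun x => by simp) hf hg

end SFun

namespace SDef

variable {n k : ℕ}

theorem eq {f g : (Fin k → ℕ) → ℕ} (hf : SFun n f) (hg : SFun n g) : SDef n fun x => f x = g x :=
  comp₂ (P := fun a b => a = b)
    (of_hier_zero (Hier.eq .pi 0 (v 0) (v 1)) fun x => by simp) hf hg

theorem le {f g : (Fin k → ℕ) → ℕ} (hf : SFun n f) (hg : SFun n g) : SDef n fun x => f x ≤ g x :=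
  comp₂ (P := fun a b => a ≤ b)
    (of_hier_zero (Hier.le .pi 0 (v 0) (v 1)) fun x => by simp) hf hg

theorem lt {f g : (Fin k → ℕ) → ℕ} (hf : SFun n f) (hg : SFun n g) : SDef n fun x => f x < g x :=
  comp₂ (P := fun a b => a < b)
    (of_hier_zero (Hier.le .pi 0 (succ (v 0)) (v 1)) fun x => by
      rw [sat_le, val_succ, val_var, val_var, msucc_nat, mle_nat]; rfl) hf hg

end SDef

theorem SFun.pair {n k : ℕ} {f g : (Fin k → ℕ) → ℕ} (hf : SFun n f) (hg : SFun n g) :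
    SFun n fun x => Nat.pair (f x) (g x) := by
  refine SFun.comp₂ (F := Nat.pair) ?_ hf hg
  have h : SDef n fun x : Fin 3 → ℕ => (x 0 < x 1 ∧ x 2 = x 1 * x 1 + x 0) ∨
      (x 1 ≤ x 0 ∧ x 2 = x 0 * x 0 + x 0 + x 1) := by
    -- Definability is read off from the shape of the relation, with variables and constants at the
    -- leaves.
    repeat' with_reducible first
      | apply SFun.var | apply SFun.const
      | apply SDef.and | apply SDef.or | apply SDef.lt | apply SDef.le | apply SDef.eq
      | apply SFun.add | apply SFun.mul
  refine h.congr fun x => ?_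
  unfold Nat.pair
  split_ifs with hlt
  · simp [hlt]
  · simp [hlt, not_lt.1 hlt]

/-- `Nat.beta` is a remainder after unpairing, and division with a quotient `q` and a bound on the
remainder describes it without `%`. -/
theorem SFun.beta {n k : ℕ} {f g : (Fin k → ℕ) → ℕ} (hf : SFun n f) (hg : SFun n g) :
    SFun n fun x => Nat.beta (f x) (g x) := by
  refine SFun.comp₂ (F := Nat.beta) ?_ hf hg
  have h : SDef n fun x : Fin 3 → ℕ => ∃ a b q, x 0 = Nat.pair a b ∧
      x 2 < (x 1 + 1) * b + 1 ∧ a = ((x 1 + 1) * b + 1) * q + x 2 := by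
    repeat' with_reducible first
      | apply SFun.var | apply SFun.const
      | apply SDef.and | apply SDef.ex | apply SDef.lt | apply SDef.eq
      | apply SFun.add | apply SFun.mul | apply SFun.pair
  refine h.congr fun x => ?_
  constructor
  · intro h
    refine ⟨(x 0).unpair.1, (x 0).unpair.2, (x 0).unpair.1 / ((x 1 + 1) * (x 0).unpair.2 + 1),
      (Nat.pair_unpair _).symm, ?_, ?_⟩
    · rw [h]
      exact Nat.mod_lt _ (Nat.succ_pos _)
    · rw [h]
      exact (Nat.div_add_mod _ _).symm
  · rintro ⟨a, b, q, h₀, h₁, h₂⟩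
    rw [h₀, Nat.beta, Nat.unpair_pair]
    simp only
    rw [h₂, Nat.mul_add_mod, Nat.mod_eq_of_lt h₁]

/-! ## Inductively generated sets -/

/-- The least set containing `R₀` and closed under the rules `y, z ⊢ x` for `R₂ x y z`. -/
inductive Clo (R₀ : ℕ → Prop) (R₂ : ℕ → ℕ → ℕ → Prop) : ℕ → Prop
  | base {x : ℕ} : R₀ x → Clo R₀ R₂ x
  | step {x y z : ℕ} : R₂ x y z → Clo R₀ R₂ y → Clo R₀ R₂ z → Clo R₀ R₂ x

/-- Each entry of the list is generated from later ones. -/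
def IsDerivation (R₀ : ℕ → Prop) (R₂ : ℕ → ℕ → ℕ → Prop) : List ℕ → Prop
  | [] => True
  | x :: l => (R₀ x ∨ ∃ y ∈ l, ∃ z ∈ l, R₂ x y z) ∧ IsDerivation R₀ R₂ l

section

variable {R₀ : ℕ → Prop} {R₂ : ℕ → ℕ → ℕ → Prop}

theorem IsDerivation.append {l l' : List ℕ} (h : IsDerivation R₀ R₂ l)
    (h' : IsDerivation R₀ R₂ l') : IsDerivation R₀ R₂ (l ++ l') := by
  induction l with
  | nil => exact h'
  | cons x l ih =>
    refine ⟨h.1.imp_right ?_, ih h.2⟩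
    rintro ⟨y, hy, z, hz, hr⟩
    exact ⟨y, List.mem_append_left _ hy, z, List.mem_append_left _ hz, hr⟩

theorem Clo.exists_isDerivation {x : ℕ} (h : Clo R₀ R₂ x) :
    ∃ l, IsDerivation R₀ R₂ (x :: l) := by
  induction h with
  | base h => exact ⟨[], Or.inl h, trivial⟩
  | @step x y z h _ _ ih₁ ih₂ =>
    obtain ⟨l₁, h₁⟩ := ih₁
    obtain ⟨l₂, h₂⟩ := ih₂
    exact ⟨(y :: l₁) ++ (z :: l₂), Or.inr ⟨y, by simp, z, by simp, h⟩, h₁.append h₂⟩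

theorem IsDerivation.getElem {l : List ℕ} (h : IsDerivation R₀ R₂ l) (i : ℕ) (hi : i < l.length) :
    R₀ l[i] ∨ ∃ (j k : ℕ) (hj : j < l.length) (hk : k < l.length), i < j ∧ i < k ∧
      R₂ l[i] l[j] l[k] := by
  induction l generalizing i with
  | nil => simp at hi
  | cons x l ih =>
    cases i with
    | zero =>
      refine h.1.imp_right ?_
      rintro ⟨y, hy, z, hz, hr⟩
      obtain ⟨j, hj, rfl⟩ := List.getElem_of_mem hy
      obtain ⟨k, hk, rfl⟩ := List.getElem_of_mem hz
      exact ⟨j + 1, k + 1, by simpa, by simpa, by omega, by omega, hr⟩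
    | succ i =>
      refine (ih h.2 i (by simpa using hi)).imp_right ?_
      rintro ⟨j, k, hj, hk, hij, hik, hr⟩
      exact ⟨j + 1, k + 1, by simpa, by simpa, by omega, by omega, hr⟩

/-- A derivation is coded by the beta function with its conclusion at index 0 and premises at larger
indices. Conversely, any `s` and `l` satisfying the local condition yield members, by induction on
the distance `l - i` to the end. -/
theorem clo_iff_exists_beta {x : ℕ} : Clo R₀ R₂ x ↔ ∃ s l, x = Nat.beta s 0 ∧ ∀ i ≤ l,
    R₀ (Nat.beta s i) ∨ ∃ j k, j ≤ l ∧ k ≤ l ∧ i < j ∧ i < k ∧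
      R₂ (Nat.beta s i) (Nat.beta s j) (Nat.beta s k) := by
  constructor
  · intro h
    obtain ⟨l, h⟩ := h.exists_isDerivation
    have hb : ∀ i (hi : i < (x :: l).length), Nat.beta (Nat.unbeta (x :: l)) i = (x :: l)[i] :=
      fun i hi => Nat.beta_unbeta_coe (x :: l) ⟨i, hi⟩
    refine ⟨Nat.unbeta (x :: l), l.length, (hb 0 (by simp)).symm, fun i hi => ?_⟩
    rw [hb i (by simpa [Nat.lt_succ_iff] using hi)]
    refine (h.getElem i (by simpa [Nat.lt_succ_iff] using hi)).imp_right ?_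
    rintro ⟨j, k, hj, hk, hij, hik, hr⟩
    refine ⟨j, k, by simpa [Nat.lt_succ_iff] using hj, by simpa [Nat.lt_succ_iff] using hk, hij,
      hik, ?_⟩
    rwa [hb j hj, hb k hk]
  · rintro ⟨s, l, rfl, h⟩
    suffices ∀ d i, l - i = d → i ≤ l → Clo R₀ R₂ (Nat.beta s i) from
      this _ 0 rfl (Nat.zero_le _)
    intro d
    induction d using Nat.strong_induction_on with
    | _ d ih =>
      rintro i rfl hi
      rcases h i hi with h | ⟨j, k, hj, hk, hij, hik, hr⟩
      · exact .base h
      · exact .step hr (ih _ (by omega) j rfl hj) (ih _ (by omega) k rfl hk)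

/-- Closing under rules adds only existential and bounded quantifiers. The syntactic notions below
are therefore all presented as instances of `Clo`. -/
theorem SDef.clo {n : ℕ} (h₀ : SDef₁ n R₀) (h₂ : SDef₃ n R₂) : SDef₁ n (Clo R₀ R₂) := by
  simp only [SDef₁, clo_iff_exists_beta]
  refine SDef.ex (SDef.ex (SDef.and ?_ (SDef.ball_var (Fin.last 2) ?_)))
  all_goals repeat' with_reducible first
    | apply SFun.var | apply SFun.const
    | apply SDef.and | apply SDef.or | apply SDef.ex | apply SDef.lt | apply SDef.le
    | apply SDef.eq | apply SDef.comp h₀ | apply SDef.comp₃ h₂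
    | apply SFun.beta

end

/-! ## Arithmetization of syntax -/

/-- The code of an implication. -/
abbrev cImp (a b : ℕ) : ℕ := Nat.pair 3 (Nat.pair a b)

/-- The code of a universal formula. -/
abbrev cAll (a : ℕ) : ℕ := Nat.pair 4 a

/-- The code of an equation. -/
abbrev cEq (a b : ℕ) : ℕ := Nat.pair 1 (Nat.pair a b)

/-- The code of an inequality. -/
abbrev cLe (a b : ℕ) : ℕ := Nat.pair 2 (Nat.pair a b)

/-- The code of a negation. -/
abbrev cNot (a : ℕ) : ℕ := cImp a (Nat.pair 0 0)

/-- The code of a triple. -/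
abbrev triple (a b c : ℕ) : ℕ := Nat.pair a (Nat.pair b c)

/-- Codes do not record the number of variables; this is why the predicates on codes carry that
number as a separate argument. -/
theorem codeTm_liftTm {k : ℕ} (t : Tm k) : codeTm (liftTm t) = codeTm t := by
  induction t with
  | var x => rcases x with e | i; exacts [e.elim, rfl]
  | func f ts ih =>
    have ih' : ∀ i, codeTm (FirstOrder.Language.Term.relabel (Sum.map id Fin.castSucc) (ts i)) =
      codeTm (ts i) := ih
    cases f <;> simp [liftTm, FirstOrder.Language.Term.relabel, codeTm, ih']

/-! ### Terms and formulas -/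

/-- `c` is the code of a term in `k` variables. -/
def IsTmCode (k c : ℕ) : Prop := ∃ t : Tm k, codeTm t = c

/-- The codes of variables and of zero. -/
def tmBase (x : ℕ) : Prop :=
  ∃ k c, x = Nat.pair k c ∧ ((∃ i, i < k ∧ c = Nat.pair 0 i) ∨ c = Nat.pair 1 0)

/-- The formation of composite terms. -/
def tmStep (x y z : ℕ) : Prop :=
  ∃ k a b, y = Nat.pair k a ∧ z = Nat.pair k b ∧ (x = Nat.pair k (Nat.pair 2 a) ∨
    x = Nat.pair k (Nat.pair 3 (Nat.pair a b)) ∨ x = Nat.pair k (Nat.pair 4 (Nat.pair a b)))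

theorem isTmCode_iff_clo (k c : ℕ) : IsTmCode k c ↔ Clo tmBase tmStep (Nat.pair k c) := by
  constructor
  · rintro ⟨t, rfl⟩
    induction t with
    | var x =>
      rcases x with e | i
      · exact e.elim
      · exact .base ⟨k, _, rfl, Or.inl ⟨i, i.2, rfl⟩⟩
    | func f ts ih =>
      cases f with
      | zero => exact .base ⟨k, _, rfl, Or.inr rfl⟩
      -- A rule with a single premise receives it twice, since `Clo` has only binary rules.
      | succ => exact .step ⟨k, _, _, rfl, rfl, Or.inl rfl⟩ (ih 0) (ih 0)
      | add => exact .step ⟨k, _, _, rfl, rfl, Or.inr (Or.inl rfl)⟩ (ih 0) (ih 1)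
      | mul => exact .step ⟨k, _, _, rfl, rfl, Or.inr (Or.inr rfl)⟩ (ih 0) (ih 1)
  · generalize hx : Nat.pair k c = x
    intro h
    induction h generalizing k c with
    | base h =>
      obtain ⟨k', c', rfl, h⟩ := h
      obtain ⟨rfl, rfl⟩ := Nat.pair_eq_pair.1 hx
      rcases h with ⟨i, hi, rfl⟩ | rfl
      · exact ⟨v ⟨i, hi⟩, rfl⟩
      · exact ⟨zero, rfl⟩
    | step h _ _ ih₁ ih₂ =>
      obtain ⟨k', a, b, rfl, rfl, h⟩ := h
      obtain ⟨t, rfl⟩ := ih₁ _ _ rfl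
      obtain ⟨u, rfl⟩ := ih₂ _ _ rfl
      rcases h with rfl | rfl | rfl <;> obtain ⟨rfl, rfl⟩ := Nat.pair_eq_pair.1 hx
      · exact ⟨succ t, rfl⟩
      · exact ⟨add t u, rfl⟩
      · exact ⟨mul t u, rfl⟩

theorem sdef_isTmCode (n : ℕ) : SDef₂ n IsTmCode := by
  have h₀ : SDef₁ n tmBase := by
    unfold tmBase
    repeat' with_reducible first
      | apply SFun.var | apply SFun.const
      | apply SDef.and | apply SDef.or | apply SDef.ex | apply SDef.lt | apply SDef.eq
      | apply SFun.pair
  have h₂ : SDef₃ n tmStep := by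
    unfold tmStep
    repeat' with_reducible first
      | apply SFun.var | apply SFun.const
      | apply SDef.and | apply SDef.or | apply SDef.ex | apply SDef.eq | apply SFun.pair
  exact (SDef.comp (SDef.clo h₀ h₂) (SFun.pair (SFun.var 0) (SFun.var 1))).congr
    fun x => isTmCode_iff_clo _ _

/-- `c` is the code of a formula in `k` variables. -/
def IsFmCode (k c : ℕ) : Prop := ∃ φ : Fm k, code φ = c

/-- `c` is the code of an atomic formula in `k` variables. -/
def IsAtomCode (k c : ℕ) : Prop :=
  c = Nat.pair 0 0 ∨ ∃ t u, IsTmCode k t ∧ IsTmCode k u ∧ (c = cEq t u ∨ c = cLe t u)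

/-- The codes of atomic formulas. -/
def fmBase (x : ℕ) : Prop := ∃ k c, x = Nat.pair k c ∧ IsAtomCode k c

/-- The formation of composite formulas. -/
def fmStep (x y z : ℕ) : Prop :=
  (∃ k a b, y = Nat.pair k a ∧ z = Nat.pair k b ∧ x = Nat.pair k (cImp a b)) ∨
  ∃ k a, y = Nat.pair (k + 1) a ∧ x = Nat.pair k (cAll a)

theorem sdef_isAtomCode (n : ℕ) : SDef₂ n IsAtomCode := by
  unfold IsAtomCode
  repeat' with_reducible first
    | apply SFun.var | apply SFun.const
    | apply SDef.and | apply SDef.or | apply SDef.ex | apply SDef.eq | apply SFun.pair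
    | apply SDef.comp₂ (sdef_isTmCode n)

theorem isFmCode_iff_clo (k c : ℕ) : IsFmCode k c ↔ Clo fmBase fmStep (Nat.pair k c) := by
  constructor
  · rintro ⟨φ, rfl⟩
    induction φ with
    | falsum => exact .base ⟨_, _, rfl, Or.inl rfl⟩
    | equal t u => exact .base ⟨_, _, rfl, Or.inr ⟨_, _, ⟨t, rfl⟩, ⟨u, rfl⟩, Or.inl rfl⟩⟩
    | rel R ts =>
      cases R
      exact .base ⟨_, _, rfl, Or.inr ⟨_, _, ⟨ts 0, rfl⟩, ⟨ts 1, rfl⟩, Or.inr rfl⟩⟩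
    | imp φ ψ ih₁ ih₂ => exact .step (Or.inl ⟨_, _, _, rfl, rfl, rfl⟩) ih₁ ih₂
    | all φ ih => exact .step (Or.inr ⟨_, _, rfl, rfl⟩) ih ih
  · generalize hx : Nat.pair k c = x
    intro h
    induction h generalizing k c with
    | base h =>
      obtain ⟨k', c', rfl, h⟩ := h
      obtain ⟨rfl, rfl⟩ := Nat.pair_eq_pair.1 hx
      rcases h with rfl | ⟨_, _, ⟨t, rfl⟩, ⟨u, rfl⟩, rfl | rfl⟩
      · exact ⟨⊥, rfl⟩
      · exact ⟨eq t u, rfl⟩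
      · exact ⟨le t u, rfl⟩
    | step h _ _ ih₁ ih₂ =>
      rcases h with ⟨k', a, b, rfl, rfl, rfl⟩ | ⟨k', a, rfl, rfl⟩
      · obtain ⟨φ, rfl⟩ := ih₁ _ _ rfl
        obtain ⟨ψ, rfl⟩ := ih₂ _ _ rfl
        obtain ⟨rfl, rfl⟩ := Nat.pair_eq_pair.1 hx
        exact ⟨φ.imp ψ, rfl⟩
      · obtain ⟨φ, rfl⟩ := ih₁ _ _ rfl
        obtain ⟨rfl, rfl⟩ := Nat.pair_eq_pair.1 hx
        exact ⟨φ.all, rfl⟩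

theorem sdef_isFmCode (n : ℕ) : SDef₂ n IsFmCode := by
  have h₀ : SDef₁ n fmBase := by
    unfold fmBase
    repeat' with_reducible first
      | apply SFun.var | apply SFun.const
      | apply SDef.and | apply SDef.ex | apply SDef.eq
      | apply SFun.pair | apply SDef.comp₂ (sdef_isAtomCode n)
  have h₂ : SDef₃ n fmStep := by
    unfold fmStep
    repeat' with_reducible first
      | apply SFun.var | apply SFun.const
      | apply SDef.and | apply SDef.or | apply SDef.ex | apply SDef.eq
      | apply SFun.pair | apply SFun.add
  exact (SDef.comp (SDef.clo h₀ h₂) (SFun.pair (SFun.var 0) (SFun.var 1))).congr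
    fun x => isFmCode_iff_clo _ _

/-! ### Substitution -/

section Substitution

variable (V : ℕ → ℕ → ℕ → Prop)

/-- Substitution of the terms with codes given by `V p` in variables and zero. -/
def substTmBase (x : ℕ) : Prop :=
  ∃ p a b, x = triple p a b ∧
    ((∃ i, a = Nat.pair 0 i ∧ V p i b) ∨ (a = Nat.pair 1 0 ∧ b = Nat.pair 1 0))

/-- Substitution in composite terms. -/
def substTmStep (x y z : ℕ) : Prop :=
  ∃ p a b a' b', y = triple p a b ∧ z = triple p a' b' ∧
    (x = triple p (Nat.pair 2 a) (Nat.pair 2 b) ∨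
     x = triple p (Nat.pair 3 (Nat.pair a a')) (Nat.pair 3 (Nat.pair b b')) ∨
     x = triple p (Nat.pair 4 (Nat.pair a a')) (Nat.pair 4 (Nat.pair b b')))

/-- The graph of the substitution in terms of the terms with codes given by `V p`. -/
def SubstTmRel (p a b : ℕ) : Prop := Clo (substTmBase V) substTmStep (triple p a b)

/-- Substitution in atomic formulas. -/
def substFmBase (x : ℕ) : Prop :=
  ∃ p a b, x = triple p a b ∧ ((a = Nat.pair 0 0 ∧ b = Nat.pair 0 0) ∨
    ∃ t u t' u', SubstTmRel V p t t' ∧ SubstTmRel V p u u' ∧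
      ((a = cEq t u ∧ b = cEq t' u') ∨ (a = cLe t u ∧ b = cLe t' u')))

/-- Substitution in composite formulas. -/
def substFmStep (x y z : ℕ) : Prop :=
  ∃ p a b a' b', y = triple p a b ∧ z = triple p a' b' ∧
    (x = triple p (cImp a a') (cImp b b') ∨ x = triple p (cAll a) (cAll b))

/-- The graph of the substitution in formulas of the terms with codes given by `V p`. -/
def SubstFmRel (p a b : ℕ) : Prop := Clo (substFmBase V) substFmStep (triple p a b)

/-- `V p` lists the codes of the terms `σ i`, and of the variables bound below. -/
def Follows (p : ℕ) {k m : ℕ} (σ : Fin k → Tm m) : Prop :=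
  (∀ (i : Fin k) c, V p i c ↔ c = codeTm (σ i)) ∧ ∀ j c, V p (k + j) c ↔ c = Nat.pair 0 (m + j)

variable {V}

/-- The parameter `p` stays the same under a binder: lifting does not change codes of terms, and the
clause `j = 0` already sends the newly bound `x_k` to `x_m`. This lets the substitution relation
treat quantifiers by a plain rule. -/
theorem Follows.snocVar {p k m : ℕ} {σ : Fin k → Tm m} (h : Follows V p σ) :
    Follows V p (snocVar σ) := by
  refine ⟨fun i c => ?_, fun j c => ?_⟩
  · refine Fin.lastCases ?_ (fun i => ?_) i
    · simpa [Arith.snocVar, codeTm] using h.2 0 c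
    · simpa [Arith.snocVar, codeTm_liftTm] using h.1 i c
  · simpa [Nat.add_assoc, Nat.add_comm 1 j] using h.2 (j + 1) c

theorem substTmRel_codeTm {p k m : ℕ} {σ : Fin k → Tm m} (h : Follows V p σ) (t : Tm k) (d : ℕ) :
    SubstTmRel V p (codeTm t) d ↔ d = codeTm (substTm σ t) := by
  constructor
  · unfold SubstTmRel
    generalize hx : triple p (codeTm t) d = x
    intro hc
    induction hc generalizing t d with
    | base hc =>
      obtain ⟨p', a, b, rfl, hc⟩ := hc
      simp only [Nat.pair_eq_pair] at hx
      obtain ⟨rfl, rfl, rfl⟩ := hx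
      rcases t with (e | i) | ⟨f, ts⟩
      · exact e.elim
      · rcases hc with ⟨j, hj, hv⟩ | ⟨ha, -⟩
        · simp only [codeTm, Nat.pair_eq_pair, true_and] at hj
          subst hj
          exact (h.1 i d).1 hv
        · simp [codeTm, Nat.pair_eq_pair] at ha
      · cases f <;> simp [codeTm, Nat.pair_eq_pair] at hc
        subst hc
        rfl
    | step hc _ _ ih₁ ih₂ =>
      obtain ⟨p', a, b, a', b', rfl, rfl, hc⟩ := hc
      rcases t with (e | i) | ⟨f, ts⟩
      · exact e.elim
      · rcases hc with rfl | rfl | rfl <;> simp [codeTm, Nat.pair_eq_pair] at hx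
      · cases f <;> rcases hc with rfl | rfl | rfl <;>
          simp [codeTm, Nat.pair_eq_pair] at hx
        · obtain ⟨rfl, rfl, rfl⟩ := hx
          rw [ih₁ _ _ rfl]
          rfl
        · obtain ⟨rfl, ⟨rfl, rfl⟩, rfl⟩ := hx
          rw [ih₁ _ _ rfl, ih₂ _ _ rfl]
          rfl
        · obtain ⟨rfl, ⟨rfl, rfl⟩, rfl⟩ := hx
          rw [ih₁ _ _ rfl, ih₂ _ _ rfl]
          rfl
  · rintro rfl
    induction t with
    | var x =>
      rcases x with e | i
      · exact e.elim
      · exact .base ⟨_, _, _, rfl, Or.inl ⟨i, rfl, (h.1 i _).2 rfl⟩⟩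
    | func f ts ih =>
      cases f with
      | zero => exact .base ⟨_, _, _, rfl, Or.inr ⟨rfl, rfl⟩⟩
      | succ => exact .step ⟨_, _, _, _, _, rfl, rfl, Or.inl rfl⟩ (ih 0) (ih 0)
      | add => exact .step ⟨_, _, _, _, _, rfl, rfl, Or.inr (Or.inl rfl)⟩ (ih 0) (ih 1)
      | mul => exact .step ⟨_, _, _, _, _, rfl, rfl, Or.inr (Or.inr rfl)⟩ (ih 0) (ih 1)

theorem substFmRel_code {p k m : ℕ} {σ : Fin k → Tm m} (h : Follows V p σ) (φ : Fm k) (d : ℕ) :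
    SubstFmRel V p (code φ) d ↔ d = code (subst φ σ) := by
  constructor
  · unfold SubstFmRel
    generalize hx : triple p (code φ) d = x
    intro hc
    induction hc generalizing k m φ d with
    | base hc =>
      obtain ⟨p', a, b, rfl, hc⟩ := hc
      simp only [Nat.pair_eq_pair] at hx
      obtain ⟨rfl, rfl, rfl⟩ := hx
      rcases φ with _ | ⟨t, u⟩ | ⟨R, ts⟩ | ⟨φ, ψ⟩ | φ
      · simp [code, Nat.pair_eq_pair] at hc
        subst hc
        rfl
      · rcases hc with ⟨hc, -⟩ | ⟨_, _, t', u', h₁, h₂, ⟨hc, rfl⟩ | ⟨hc, -⟩⟩ <;>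
          simp [code, Nat.pair_eq_pair] at hc
        obtain ⟨rfl, rfl⟩ := hc
        rw [(substTmRel_codeTm h t _).1 h₁, (substTmRel_codeTm h u _).1 h₂]
        rfl
      · cases R
        rcases hc with ⟨hc, -⟩ | ⟨_, _, t', u', h₁, h₂, ⟨hc, -⟩ | ⟨hc, rfl⟩⟩ <;>
          simp [code, Nat.pair_eq_pair] at hc
        obtain ⟨rfl, rfl⟩ := hc
        rw [(substTmRel_codeTm h _ _).1 h₁, (substTmRel_codeTm h _ _).1 h₂]
        rfl
      · simp [code, Nat.pair_eq_pair] at hc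
      · simp [code, Nat.pair_eq_pair] at hc
    | step hc _ _ ih₁ ih₂ =>
      obtain ⟨p', a, b, a', b', rfl, rfl, hc⟩ := hc
      rcases φ with _ | ⟨t, u⟩ | ⟨R, ts⟩ | ⟨φ, ψ⟩ | φ
      · rcases hc with rfl | rfl <;> simp [code, Nat.pair_eq_pair] at hx
      · rcases hc with rfl | rfl <;> simp [code, Nat.pair_eq_pair] at hx
      · cases R
        rcases hc with rfl | rfl <;> simp [code, Nat.pair_eq_pair] at hx
      · rcases hc with rfl | rfl <;> simp [code, Nat.pair_eq_pair] at hx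
        obtain ⟨rfl, ⟨rfl, rfl⟩, rfl⟩ := hx
        rw [ih₁ h _ _ rfl, ih₂ h _ _ rfl]
        rfl
      · rcases hc with rfl | rfl <;> simp [code, Nat.pair_eq_pair] at hx
        obtain ⟨rfl, rfl, rfl⟩ := hx
        rw [ih₁ h.snocVar _ _ rfl]
        rfl
  · rintro rfl
    induction φ generalizing m with
    | falsum => exact .base ⟨_, _, _, rfl, Or.inl ⟨rfl, rfl⟩⟩
    | equal t u =>
      exact .base ⟨_, _, _, rfl, Or.inr ⟨_, _, _, _, (substTmRel_codeTm h t _).2 rfl,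
        (substTmRel_codeTm h u _).2 rfl, Or.inl ⟨rfl, rfl⟩⟩⟩
    | rel R ts =>
      cases R
      exact .base ⟨_, _, _, rfl, Or.inr ⟨_, _, _, _, (substTmRel_codeTm h (ts 0) _).2 rfl,
        (substTmRel_codeTm h (ts 1) _).2 rfl, Or.inr ⟨rfl, rfl⟩⟩⟩
    | imp φ ψ ih₁ ih₂ =>
      exact .step ⟨_, _, _, _, _, rfl, rfl, Or.inl rfl⟩ (ih₁ h) (ih₂ h)
    | all φ ih =>
      exact .step ⟨_, _, _, _, _, rfl, rfl, Or.inr rfl⟩ (ih h.snocVar) (ih h.snocVar)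

theorem sdef_substFmRel {n : ℕ} (hV : SDef₃ n V) : SDef₃ n (SubstFmRel V) := by
  have h₀ : SDef₁ n (substTmBase V) := by
    unfold substTmBase
    repeat' with_reducible first
      | apply SFun.var | apply SFun.const
      | apply SDef.and | apply SDef.or | apply SDef.ex | apply SDef.eq
      | apply SFun.pair | apply SDef.comp₃ hV
  have h₂ : SDef₃ n substTmStep := by
    unfold substTmStep
    repeat' with_reducible first
      | apply SFun.var | apply SFun.const
      | apply SDef.and | apply SDef.or | apply SDef.ex | apply SDef.eq | apply SFun.pair
  have ht : SDef₃ n (SubstTmRel V) :=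
    SDef.comp (SDef.clo h₀ h₂) ((SFun.var 0).pair ((SFun.var 1).pair (SFun.var 2)))
  have h₀' : SDef₁ n (substFmBase V) := by
    unfold substFmBase
    repeat' with_reducible first
      | apply SFun.var | apply SFun.const
      | apply SDef.and | apply SDef.or | apply SDef.ex | apply SDef.eq
      | apply SFun.pair | apply SDef.comp₃ ht
  have h₂' : SDef₃ n substFmStep := by
    unfold substFmStep
    repeat' with_reducible first
      | apply SFun.var | apply SFun.const
      | apply SDef.and | apply SDef.or | apply SDef.ex | apply SDef.eq | apply SFun.pair
  exact SDef.comp (SDef.clo h₀' h₂') ((SFun.var 0).pair ((SFun.var 1).pair (SFun.var 2)))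

end Substitution

/-- The substitution behind `inst`, with parameter the number of variables and the term. -/
def instRel (p i c : ℕ) : Prop :=
  ∃ k t, p = Nat.pair k t ∧ ((i < k ∧ c = Nat.pair 0 i) ∨ (i = k ∧ c = t) ∨
    ∃ j, k ≤ j ∧ i = j + 1 ∧ c = Nat.pair 0 j)

/-- The substitution behind `lift`, with parameter the number of variables. -/
def liftRel (k i c : ℕ) : Prop :=
  (i < k ∧ c = Nat.pair 0 i) ∨ (k ≤ i ∧ c = Nat.pair 0 (i + 1))

/-- The substitution behind `ofSentence`, with parameter the number of variables. -/
def sentenceRel (k i c : ℕ) : Prop := c = Nat.pair 0 (i + k)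

theorem sdef_instRel (n : ℕ) : SDef₃ n instRel := by
  unfold instRel
  repeat' with_reducible first
    | apply SFun.var | apply SFun.const
    | apply SDef.and | apply SDef.or | apply SDef.ex | apply SDef.eq | apply SDef.lt
    | apply SDef.le | apply SFun.pair | apply SFun.add

theorem sdef_liftRel (n : ℕ) : SDef₃ n liftRel := by
  unfold liftRel
  repeat' with_reducible first
    | apply SFun.var | apply SFun.const
    | apply SDef.and | apply SDef.or | apply SDef.eq | apply SDef.lt
    | apply SDef.le | apply SFun.pair | apply SFun.add

theorem sdef_sentenceRel (n : ℕ) : SDef₃ n sentenceRel := by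
  unfold sentenceRel
  repeat' with_reducible first
    | apply SFun.var | apply SDef.eq | apply SFun.pair | apply SFun.add | apply SFun.const

/-- The third clause of `instRel` reflects that `x_k` disappears, so variables bound inside the
formula move down by one index. -/
theorem substFmRel_inst {k : ℕ} (φ : Fm (k + 1)) (t : Tm k) (d : ℕ) :
    SubstFmRel instRel (Nat.pair k (codeTm t)) (code φ) d ↔ d = code (inst φ t) := by
  refine substFmRel_code ⟨fun i c => ?_, fun j c => ?_⟩ φ d
  · refine Fin.lastCases ?_ (fun i => ?_) i
    · rw [Fin.snoc_last]
      constructor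
      · rintro ⟨k', t', hp, h⟩
        obtain ⟨rfl, rfl⟩ := Nat.pair_eq_pair.1 hp
        rcases h with ⟨h, -⟩ | ⟨-, h⟩ | ⟨j, h₁, h₂, -⟩
        · simp at h
        · exact h
        · simp at h₂; omega
      · rintro rfl
        exact ⟨k, _, rfl, Or.inr (Or.inl ⟨rfl, rfl⟩)⟩
    · rw [Fin.snoc_castSucc]
      constructor
      · rintro ⟨k', t', hp, h⟩
        obtain ⟨rfl, rfl⟩ := Nat.pair_eq_pair.1 hp
        have hi := i.2
        rcases h with ⟨-, h⟩ | ⟨h, -⟩ | ⟨j, h₁, h₂, -⟩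
        · exact h
        · simp at h; omega
        · simp at h₂; omega
      · rintro rfl
        exact ⟨k, _, rfl, Or.inl ⟨i.2, rfl⟩⟩
  · constructor
    · rintro ⟨k', t', hp, h⟩
      obtain ⟨rfl, rfl⟩ := Nat.pair_eq_pair.1 hp
      rcases h with ⟨h, -⟩ | ⟨h, -⟩ | ⟨j', h₁, h₂, rfl⟩
      · omega
      · omega
      · congr 1; omega
    · rintro rfl
      exact ⟨k, _, rfl, Or.inr (Or.inr ⟨k + j, by omega, by omega, rfl⟩)⟩

theorem substFmRel_lift {k : ℕ} (φ : Fm k) (d : ℕ) :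
    SubstFmRel liftRel k (code φ) d ↔ d = code (lift φ) := by
  refine substFmRel_code ⟨fun i c => ?_, fun j c => ?_⟩ φ d
  · simp [liftRel, codeTm]
  · simp [liftRel, Nat.add_right_comm]

theorem substFmRel_ofSentence (φ : lang.Sentence) (k d : ℕ) :
    SubstFmRel sentenceRel k (code (k := 0) φ) d ↔ d = code (ofSentence φ k) := by
  refine substFmRel_code ⟨fun i => i.elim0, fun j c => ?_⟩ _ d
  simp [sentenceRel, Nat.add_comm]

/-! ### The hierarchy -/

/-- The code of a quadruple. -/
abbrev quad (a b c d : ℕ) : ℕ := Nat.pair a (triple b c d)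

/-- The code of an existential formula. -/
abbrev cEx (a : ℕ) : ℕ := cNot (cAll (cNot a))

/-- The code of `ballLE`. -/
abbrev cBall (k t a : ℕ) : ℕ := cAll (cImp (cLe (Nat.pair 0 k) t) a)

/-- The code of `bexLE`. -/
abbrev cBex (k t a : ℕ) : ℕ := cEx (cNot (cImp (cLe (Nat.pair 0 k) t) (cNot a)))

theorem code_ballLE {k : ℕ} (t : Tm k) (φ : Fm (k + 1)) :
    code (ballLE t φ) = cBall k (codeTm t) (code φ) := by
  rw [← codeTm_liftTm t]; rfl

theorem code_bexLE {k : ℕ} (t : Tm k) (φ : Fm (k + 1)) :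
    code (bexLE t φ) = cBex k (codeTm t) (code φ) := by
  rw [← codeTm_liftTm t]; rfl

/-- Codes of the two sides of the hierarchy. -/
def sideCode : Side → ℕ
  | .sigma => 0
  | .pi => 1

/-- Duality of sides becomes the arithmetical condition `s + s' = 1` in `hierStep`. -/
theorem sideCode_add {s s' : Side} : sideCode s + sideCode s' = 1 ↔ s' = s.dual := by
  cases s <;> cases s' <;> simp [sideCode, Side.dual]

theorem eq_sigma_of_sideCode {s : Side} (h : sideCode s = 0) : s = .sigma := by
  cases s
  · rfl
  · exact absurd h one_ne_zero

theorem eq_pi_of_sideCode {s : Side} (h : sideCode s = 1) : s = .pi := by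
  cases s
  · exact absurd h zero_ne_one
  · rfl

theorem exists_sideCode {s : ℕ} (h : s ≤ 1) : ∃ s' : Side, sideCode s' = s := by
  obtain rfl | rfl : s = 0 ∨ s = 1 := by omega
  exacts [⟨.sigma, rfl⟩, ⟨.pi, rfl⟩]

/-- `c` is the code of a `Σ_n`- or `Π_n`-formula in `k` variables, according to `s`. -/
def IsHierCode (s n k c : ℕ) : Prop :=
  ∃ (s' : Side) (φ : Fm k), sideCode s' = s ∧ code φ = c ∧ Hier s' n φ

/-- Atomic formulas are in all classes of the hierarchy. -/
def hierBase (x : ℕ) : Prop := ∃ s n k c, x = quad s n k c ∧ s ≤ 1 ∧ IsAtomCode k c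

/-- The rules that generate the classes of the hierarchy. -/
def hierStep (x y z : ℕ) : Prop :=
  ∃ s s' n k a b t, s + s' = 1 ∧ (
    (y = quad s' n k a ∧ z = quad s n k b ∧ x = quad s n k (cImp a b)) ∨
    (y = quad s' n k a ∧ x = quad s (n + 1) k a) ∨
    (y = quad s n (k + 1) a ∧ IsTmCode k t ∧ x = quad s n k (cBall k t a)) ∨
    (y = quad s n (k + 1) a ∧ IsTmCode k t ∧ x = quad s n k (cBex k t a)) ∨
    (y = quad 0 (n + 1) (k + 1) a ∧ x = quad 0 (n + 1) k (cEx a)) ∨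
    (y = quad 1 (n + 1) (k + 1) a ∧ x = quad 1 (n + 1) k (cAll a)))

theorem hierStep.clo {x y z s s' n k a b t : ℕ} (hs : s + s' = 1) (h :
    (y = quad s' n k a ∧ z = quad s n k b ∧ x = quad s n k (cImp a b)) ∨
    (y = quad s' n k a ∧ x = quad s (n + 1) k a) ∨
    (y = quad s n (k + 1) a ∧ IsTmCode k t ∧ x = quad s n k (cBall k t a)) ∨
    (y = quad s n (k + 1) a ∧ IsTmCode k t ∧ x = quad s n k (cBex k t a)) ∨
    (y = quad 0 (n + 1) (k + 1) a ∧ x = quad 0 (n + 1) k (cEx a)) ∨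
    (y = quad 1 (n + 1) (k + 1) a ∧ x = quad 1 (n + 1) k (cAll a)))
    (hy : Clo hierBase hierStep y) (hz : Clo hierBase hierStep z) : Clo hierBase hierStep x :=
  .step ⟨s, s', n, k, a, b, t, hs, h⟩ hy hz

theorem isHierCode_iff_clo (s n k c : ℕ) :
    IsHierCode s n k c ↔ Clo hierBase hierStep (quad s n k c) := by
  constructor
  · rintro ⟨s, φ, rfl, rfl, h⟩
    have hle : ∀ s, sideCode s ≤ 1 := fun s => by cases s <;> simp [sideCode]
    have hd : ∀ s, sideCode s + sideCode s.dual = 1 := fun s => sideCode_add.2 rfl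
    induction h with
    | falsum s n => exact .base ⟨_, _, _, _, rfl, hle s, Or.inl rfl⟩
    | eq s n t u =>
      exact .base ⟨_, _, _, _, rfl, hle s, Or.inr ⟨_, _, ⟨t, rfl⟩, ⟨u, rfl⟩, Or.inl rfl⟩⟩
    | le s n t u =>
      exact .base ⟨_, _, _, _, rfl, hle s, Or.inr ⟨_, _, ⟨t, rfl⟩, ⟨u, rfl⟩, Or.inr rfl⟩⟩
    | @imp s n k φ ψ _ _ ih₁ ih₂ =>
      -- Here and below, parameters that do not occur in the rule applied are set to 0.
      exact hierStep.clo (t := 0) (hd s) (Or.inl ⟨rfl, rfl, rfl⟩) ih₁ ih₂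
    | @ballLE s n k t φ _ ih =>
      rw [code_ballLE]
      exact hierStep.clo (b := 0) (hd s) (Or.inr (Or.inr (Or.inl ⟨rfl, ⟨t, rfl⟩, rfl⟩))) ih ih
    | @bexLE s n k t φ _ ih =>
      rw [code_bexLE]
      exact hierStep.clo (b := 0) (hd s)
        (Or.inr (Or.inr (Or.inr (Or.inl ⟨rfl, ⟨t, rfl⟩, rfl⟩)))) ih ih
    | @up s n k φ _ ih =>
      exact hierStep.clo (b := 0) (t := 0) (hd s) (Or.inr (Or.inl ⟨rfl, rfl⟩)) ih ih
    | ex _ ih =>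
      exact hierStep.clo (b := 0) (t := 0) (hd .sigma)
        (Or.inr (Or.inr (Or.inr (Or.inr (Or.inl ⟨rfl, rfl⟩))))) ih ih
    | all _ ih =>
      exact hierStep.clo (b := 0) (t := 0) (hd .sigma)
        (Or.inr (Or.inr (Or.inr (Or.inr (Or.inr ⟨rfl, rfl⟩))))) ih ih
  · generalize hx : quad s n k c = x
    intro h
    induction h generalizing s n k c with
    | base h =>
      obtain ⟨s', n', k', c', rfl, hs, h⟩ := h
      simp only [Nat.pair_eq_pair] at hx
      obtain ⟨rfl, rfl, rfl, rfl⟩ := hx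
      obtain ⟨s', rfl⟩ := exists_sideCode hs
      rcases h with rfl | ⟨_, _, ⟨t, rfl⟩, ⟨u, rfl⟩, rfl | rfl⟩
      · exact ⟨s', ⊥, rfl, rfl, .falsum _ _⟩
      · exact ⟨s', _, rfl, rfl, .eq _ _ t u⟩
      · exact ⟨s', _, rfl, rfl, .le _ _ t u⟩
    | @step x y z h _ _ ih₁ ih₂ =>
      obtain ⟨s', s'', n', k', a, b, t, hs, h⟩ := h
      have hq : ∀ {s₁ n₁ k₁ c₁ : ℕ}, x = quad s₁ n₁ k₁ c₁ →
          s = s₁ ∧ n = n₁ ∧ k = k₁ ∧ c = c₁ := by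
        intro s₁ n₁ k₁ c₁ h
        simpa only [Nat.pair_eq_pair] using hx.trans h
      clear hx
      rcases h with ⟨hy, hz, h⟩ | ⟨hy, h⟩ | ⟨hy, ⟨t, rfl⟩, h⟩ | ⟨hy, ⟨t, rfl⟩, h⟩ | ⟨hy, h⟩ |
        ⟨hy, h⟩
      · obtain ⟨rfl, rfl, rfl, rfl⟩ := hq h
        obtain ⟨s₁, φ, rfl, rfl, hφ⟩ := ih₁ _ _ _ _ hy.symm
        obtain ⟨s₂, ψ, rfl, rfl, hψ⟩ := ih₂ _ _ _ _ hz.symm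
        obtain rfl := sideCode_add.1 hs
        exact ⟨_, _, rfl, rfl, .imp hφ hψ⟩
      · obtain ⟨rfl, rfl, rfl, rfl⟩ := hq h
        obtain ⟨s₁, φ, rfl, rfl, hφ⟩ := ih₁ _ _ _ _ hy.symm
        obtain ⟨s₂, rfl⟩ := exists_sideCode (s := s) (by omega)
        obtain rfl := sideCode_add.1 hs
        exact ⟨_, _, rfl, rfl, .up hφ⟩
      · obtain ⟨rfl, rfl, rfl, rfl⟩ := hq h
        obtain ⟨s₁, φ, h₁, rfl, hφ⟩ := ih₁ _ _ _ _ hy.symm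
        exact ⟨s₁, _, h₁, code_ballLE t φ, .ballLE t hφ⟩
      · obtain ⟨rfl, rfl, rfl, rfl⟩ := hq h
        obtain ⟨s₁, φ, h₁, rfl, hφ⟩ := ih₁ _ _ _ _ hy.symm
        exact ⟨s₁, _, h₁, code_bexLE t φ, .bexLE t hφ⟩
      · obtain ⟨rfl, rfl, rfl, rfl⟩ := hq h
        obtain ⟨s₁, φ, h₁, rfl, hφ⟩ := ih₁ _ _ _ _ hy.symm
        obtain rfl := eq_sigma_of_sideCode h₁
        exact ⟨.sigma, _, rfl, rfl, .ex hφ⟩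
      · obtain ⟨rfl, rfl, rfl, rfl⟩ := hq h
        obtain ⟨s₁, φ, h₁, rfl, hφ⟩ := ih₁ _ _ _ _ hy.symm
        obtain rfl := eq_pi_of_sideCode h₁
        exact ⟨.pi, _, rfl, rfl, .all hφ⟩

theorem sdef_isPiCode (n m : ℕ) :
    SDef₁ n fun c => ∃ φ : lang.Sentence, code (k := 0) φ = c ∧ IsPi m (k := 0) φ := by
  have h₀ : SDef₁ n hierBase := by
    unfold hierBase
    repeat' with_reducible first
      | apply SFun.var | apply SFun.const
      | apply SDef.and | apply SDef.ex | apply SDef.eq | apply SDef.le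
      | apply SFun.pair | apply SDef.comp₂ (sdef_isAtomCode n)
  have h₂ : SDef₃ n hierStep := by
    unfold hierStep
    repeat' with_reducible first
      | apply SFun.var | apply SFun.const
      | apply SDef.and | apply SDef.or | apply SDef.ex | apply SDef.eq | apply SFun.add
      | apply SFun.pair | apply SDef.comp₂ (sdef_isTmCode n)
  refine (SDef.comp (SDef.clo h₀ h₂) ((SFun.const 1).pair ((SFun.const m).pair
    ((SFun.const 0).pair (SFun.var 0))))).congr fun x => ?_
  rw [← isHierCode_iff_clo]
  constructor
  · rintro ⟨φ, h, hφ⟩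
    exact ⟨.pi, φ, rfl, h, hφ⟩
  · rintro ⟨s, φ, hs, h, hφ⟩
    obtain rfl := eq_pi_of_sideCode hs
    exact ⟨φ, h, hφ⟩

/-! ### Provability -/

/-- `P` is the set of codes of the axioms of `T`. -/
def AxiomCodes (T : lang.Theory) (P : ℕ → Prop) : Prop :=
  ∀ m, P m ↔ ∃ φ ∈ T, code (k := 0) φ = m

/-- The codes of instances of the axioms and axiom schemes of the calculus. -/
def provBase (P : ℕ → Prop) (x : ℕ) : Prop :=
  ∃ k c, x = Nat.pair k c ∧ (
    (∃ a, P a ∧ SubstFmRel sentenceRel k a c) ∨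
    (∃ a b, IsFmCode k a ∧ IsFmCode k b ∧ c = cImp a (cImp b a)) ∨
    (∃ a b d, IsFmCode k a ∧ IsFmCode k b ∧ IsFmCode k d ∧
      c = cImp (cImp a (cImp b d)) (cImp (cImp a b) (cImp a d))) ∨
    (∃ a, IsFmCode k a ∧ c = cImp (cNot (cNot a)) a) ∨
    (∃ a t d, IsFmCode (k + 1) a ∧ IsTmCode k t ∧ SubstFmRel instRel (Nat.pair k t) a d ∧
      c = cImp (cAll a) d) ∨
    (∃ a b d, IsFmCode k a ∧ IsFmCode (k + 1) b ∧ SubstFmRel liftRel k a d ∧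
      c = cImp (cAll (cImp d b)) (cImp a (cAll b))) ∨
    (∃ t, IsTmCode k t ∧ c = cEq t t) ∨
    (∃ t u a d d', IsTmCode k t ∧ IsTmCode k u ∧ IsFmCode (k + 1) a ∧
      SubstFmRel instRel (Nat.pair k t) a d ∧ SubstFmRel instRel (Nat.pair k u) a d' ∧
      c = cImp (cEq t u) (cImp d d')))

/-- Modus ponens and generalization. -/
def provStep (x y z : ℕ) : Prop :=
  ∃ k a, (∃ b, y = Nat.pair k (cImp a b) ∧ z = Nat.pair k a ∧ x = Nat.pair k b) ∨
    (y = Nat.pair (k + 1) a ∧ x = Nat.pair k (cAll a))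

theorem exists_of_code_eq_cImp {k a b : ℕ} {φ : Fm k} (h : code φ = cImp a b) :
    ∃ ψ χ, φ = .imp ψ χ ∧ code ψ = a ∧ code χ = b := by
  rcases φ with _ | ⟨t, u⟩ | ⟨R, ts⟩ | ⟨φ, ψ⟩ | φ
  · simp [code, Nat.pair_eq_pair] at h
  · simp [code, Nat.pair_eq_pair] at h
  · cases R; simp [code, Nat.pair_eq_pair] at h
  · simp only [code, Nat.pair_eq_pair, true_and] at h
    exact ⟨_, _, rfl, h.1, h.2⟩
  · simp [code, Nat.pair_eq_pair] at h

theorem provable_iff_clo {T : lang.Theory} {P : ℕ → Prop} (hP : AxiomCodes T P) (k c : ℕ) :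
    (∃ φ : Fm k, code φ = c ∧ Provable T φ) ↔ Clo (provBase P) provStep (Nat.pair k c) := by
  constructor
  · rintro ⟨φ, rfl, h⟩
    induction h with
    | @ax k φ h =>
      exact .base ⟨_, _, rfl, Or.inl ⟨_, (hP _).2 ⟨φ, h, rfl⟩,
        (substFmRel_ofSentence φ k _).2 rfl⟩⟩
    | mp _ _ ih₁ ih₂ => exact .step ⟨_, _, Or.inl ⟨_, rfl, rfl, rfl⟩⟩ ih₁ ih₂
    | gen _ ih => exact .step ⟨_, _, Or.inr ⟨rfl, rfl⟩⟩ ih ih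
    | impK φ ψ => exact .base ⟨_, _, rfl, Or.inr (Or.inl ⟨_, _, ⟨φ, rfl⟩, ⟨ψ, rfl⟩, rfl⟩)⟩
    | impS φ ψ χ =>
      exact .base ⟨_, _, rfl, Or.inr (Or.inr (Or.inl
        ⟨_, _, _, ⟨φ, rfl⟩, ⟨ψ, rfl⟩, ⟨χ, rfl⟩, rfl⟩))⟩
    | dne φ => exact .base ⟨_, _, rfl, Or.inr (Or.inr (Or.inr (Or.inl ⟨_, ⟨φ, rfl⟩, rfl⟩)))⟩
    | allElim φ t =>
      exact .base ⟨_, _, rfl, Or.inr (Or.inr (Or.inr (Or.inr (Or.inl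
        ⟨_, _, _, ⟨φ, rfl⟩, ⟨t, rfl⟩, (substFmRel_inst φ t _).2 rfl, rfl⟩))))⟩
    | allImp φ ψ =>
      exact .base ⟨_, _, rfl, Or.inr (Or.inr (Or.inr (Or.inr (Or.inr (Or.inl
        ⟨_, _, _, ⟨φ, rfl⟩, ⟨ψ, rfl⟩, (substFmRel_lift φ _).2 rfl, rfl⟩)))))⟩
    | eqRefl t =>
      exact .base ⟨_, _, rfl, Or.inr (Or.inr (Or.inr (Or.inr (Or.inr (Or.inr (Or.inl
        ⟨_, ⟨t, rfl⟩, rfl⟩))))))⟩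
    | eqSubst t u φ =>
      exact .base ⟨_, _, rfl, Or.inr (Or.inr (Or.inr (Or.inr (Or.inr (Or.inr (Or.inr
        ⟨_, _, _, _, _, ⟨t, rfl⟩, ⟨u, rfl⟩, ⟨φ, rfl⟩, (substFmRel_inst φ t _).2 rfl,
          (substFmRel_inst φ u _).2 rfl, rfl⟩))))))⟩
  · generalize hx : Nat.pair k c = x
    intro h
    induction h generalizing k c with
    | base h =>
      obtain ⟨k', c', rfl, h⟩ := h
      obtain ⟨rfl, rfl⟩ := Nat.pair_eq_pair.1 hx
      rcases h with ⟨a, ha, hs⟩ | ⟨_, _, ⟨φ, rfl⟩, ⟨ψ, rfl⟩, rfl⟩ |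
        ⟨_, _, _, ⟨φ, rfl⟩, ⟨ψ, rfl⟩, ⟨χ, rfl⟩, rfl⟩ | ⟨_, ⟨φ, rfl⟩, rfl⟩ |
        ⟨_, _, d, ⟨φ, rfl⟩, ⟨t, rfl⟩, hd, rfl⟩ | ⟨_, _, d, ⟨φ, rfl⟩, ⟨ψ, rfl⟩, hd, rfl⟩ |
        ⟨_, ⟨t, rfl⟩, rfl⟩ | ⟨_, _, _, d, d', ⟨t, rfl⟩, ⟨u, rfl⟩, ⟨φ, rfl⟩, hd, hd', rfl⟩
      · obtain ⟨φ, hφ, rfl⟩ := (hP a).1 ha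
        exact ⟨_, ((substFmRel_ofSentence φ k c).1 hs).symm, .ax hφ⟩
      · exact ⟨_, rfl, .impK φ ψ⟩
      · exact ⟨_, rfl, .impS φ ψ χ⟩
      · exact ⟨_, rfl, .dne φ⟩
      · rw [substFmRel_inst] at hd
        subst hd
        exact ⟨_, rfl, .allElim φ t⟩
      · rw [substFmRel_lift] at hd
        subst hd
        exact ⟨_, rfl, .allImp φ ψ⟩
      · exact ⟨_, rfl, .eqRefl t⟩
      · rw [substFmRel_inst] at hd hd'
        subst hd hd'
        exact ⟨_, rfl, .eqSubst t u φ⟩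
    | step h _ _ ih₁ ih₂ =>
      rcases h with ⟨k', a, ⟨b, rfl, rfl, rfl⟩ | ⟨rfl, rfl⟩⟩
      · obtain ⟨rfl, rfl⟩ := Nat.pair_eq_pair.1 hx
        obtain ⟨χ, hχ, h₁⟩ := ih₁ _ _ rfl
        obtain ⟨φ, rfl, h₂⟩ := ih₂ _ _ rfl
        obtain ⟨φ', ψ, rfl, hφ, rfl⟩ := exists_of_code_eq_cImp hχ
        -- Both premises live in the same number of variables, so equal codes mean that the
        -- antecedent is the minor premise.
        rw [code_injective hφ] at h₁
        exact ⟨ψ, rfl, .mp h₁ h₂⟩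
      · obtain ⟨rfl, rfl⟩ := Nat.pair_eq_pair.1 hx
        obtain ⟨φ, rfl, h⟩ := ih₁ _ _ rfl
        exact ⟨_, rfl, .gen h⟩

/-- The axioms enter only through one base clause, and everything else is definable at every level,
so provability is no more complex than the set of axioms. -/
theorem sdef_provable {n : ℕ} {T : lang.Theory} {P : ℕ → Prop} (hT : AxiomCodes T P)
    (hP : SDef₁ n P) :
    SDef₁ n fun c => ∃ φ : lang.Sentence, code (k := 0) φ = c ∧ Proves T φ := by
  have h₀ : SDef₁ n (provBase P) := by
    unfold provBase
    repeat' with_reducible first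
      | apply SFun.var | apply SFun.const
      | apply SDef.and | apply SDef.or | apply SDef.ex | apply SDef.eq
      | apply SFun.pair | apply SFun.add | apply SDef.comp hP
      | apply SDef.comp₂ (sdef_isTmCode n) | apply SDef.comp₂ (sdef_isFmCode n)
      | apply SDef.comp₃ (sdef_substFmRel (sdef_instRel n))
      | apply SDef.comp₃ (sdef_substFmRel (sdef_liftRel n))
      | apply SDef.comp₃ (sdef_substFmRel (sdef_sentenceRel n))
  have h₂ : SDef₃ n provStep := by
    unfold provStep
    repeat' with_reducible first
      | apply SFun.var | apply SFun.const
      | apply SDef.and | apply SDef.or | apply SDef.ex | apply SDef.eq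
      | apply SFun.pair | apply SFun.add
  exact (SDef.comp (SDef.clo h₀ h₂) ((SFun.const 0).pair (SFun.var 0))).congr
    fun x => provable_iff_clo hT 0 (x 0)

/-! ### Numerals -/

/-- The rule that generates the codes of numerals. -/
def numStep (x y _z : ℕ) : Prop :=
  ∃ m a, y = Nat.pair m a ∧ x = Nat.pair (m + 1) (Nat.pair 2 a)

theorem codeTm_num_iff_clo {k : ℕ} (m c : ℕ) : c = codeTm (num m : Tm k) ↔
    Clo (fun x => x = Nat.pair 0 (Nat.pair 1 0)) numStep (Nat.pair m c) := by
  constructor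
  · rintro rfl
    induction m with
    | zero => exact .base rfl
    | succ m ih => exact .step ⟨m, _, rfl, rfl⟩ ih ih
  · generalize hx : Nat.pair m c = x
    intro h
    induction h generalizing m c with
    | base h =>
      subst h
      obtain ⟨rfl, rfl⟩ := Nat.pair_eq_pair.1 hx
      rfl
    | step h _ _ ih _ =>
      obtain ⟨m', a, rfl, rfl⟩ := h
      obtain ⟨rfl, rfl⟩ := Nat.pair_eq_pair.1 hx
      rw [ih _ _ rfl]
      rfl

theorem sfun_codeTm_num (n k : ℕ) : SDef₂ n fun m c => c = codeTm (num m : Tm k) := by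
  have h₀ : SDef₁ n fun x => x = Nat.pair 0 (Nat.pair 1 0) := by
    repeat' with_reducible first
      | apply SFun.var | apply SFun.const | apply SDef.eq
  have h₂ : SDef₃ n numStep := by
    unfold numStep
    repeat' with_reducible first
      | apply SFun.var | apply SFun.const
      | apply SDef.and | apply SDef.ex | apply SDef.eq | apply SFun.pair | apply SFun.add
  exact (SDef.comp (SDef.clo h₀ h₂) ((SFun.var 0).pair (SFun.var 1))).congr
    fun x => codeTm_num_iff_clo _ _

/-! ## Definability of provability from true sentences -/

theorem Proves.mono {T U : lang.Theory} (h : T ⊆ U) {φ : lang.Sentence} (hφ : Proves T φ) :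
    Proves U φ :=
  proves_of_models fun _ _ _ hU => Proves.models (hU.mono h) hφ

theorem Consistent.mono {T U : lang.Theory} (h : T ⊆ U) (hU : Consistent U) : Consistent T :=
  fun hT => hU (hT.mono h)

theorem ExtendsQ.qModel {T : lang.Theory} (hT : ExtendsQ T) {M : Type*} [lang.Structure M]
    [Nonempty M] (hM : M ⊨ T) : QModel M :=
  models_Q_iff.1 ⟨fun φ hφ => Proves.models hM (hT φ hφ)⟩

theorem models_of_isSigma {M : Type*} [lang.Structure M] (hM : QModel M) {n : ℕ}
    (hn : ∀ m, n = m + 1 → M ⊨ PiTh m) {φ : lang.Sentence} (hφ : IsSigma n (k := 0) φ)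
    (h : IsTrue φ) : M ⊨ φ :=
  (models_iff_sat _ _).2 ((hφ.transfer hM hn Fin.elim0).1 rfl ((models_iff_sat _ _).1 h))

theorem isTrue_of_isPi {M : Type*} [lang.Structure M] (hM : QModel M) {n : ℕ}
    (hn : ∀ m, n = m + 1 → M ⊨ PiTh m) {φ : lang.Sentence} (hφ : IsPi n (k := 0) φ)
    (h : M ⊨ φ) : IsTrue φ :=
  (models_iff_sat _ _).2 ((hφ.transfer hM hn Fin.elim0).2 rfl ((models_iff_sat _ _).1 h))

/-- At level 0 the transfer has no lower level to appeal to, so `Q` alone suffices. -/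
theorem models_piTh_zero {M : Type*} [lang.Structure M] (hM : QModel M) : M ⊨ PiTh 0 :=
  ⟨fun _ hφ => models_of_isSigma (n := 0) hM
    (fun m h => absurd h (Nat.succ_ne_zero m).symm) (hφ.1.of_zero rfl _ _) hφ.2⟩

theorem nat_models_piTh (n : ℕ) : ℕ ⊨ PiTh n := ⟨fun _ hφ => hφ.2⟩

theorem models_not_iff {M : Type*} [lang.Structure M] (φ : lang.Sentence) :
    M ⊨ (FirstOrder.Language.BoundedFormula.not (n := 0) φ : lang.Sentence) ↔ ¬ M ⊨ φ := by
  rw [models_iff_sat _ Fin.elim0, models_iff_sat φ Fin.elim0]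
  exact sat_not _ _

theorem AxiomCodes.union {T T' : lang.Theory} {P P' : ℕ → Prop} (h : AxiomCodes T P)
    (h' : AxiomCodes T' P') : AxiomCodes (T ∪ T') fun m => P m ∨ P' m := by
  intro m
  change P m ∨ P' m ↔ _
  rw [h, h']
  simp only [Set.mem_union, or_and_right, exists_or]

theorem SDef.of_finite {n : ℕ} {S : Set ℕ} (hS : S.Finite) : SDef₁ n (· ∈ S) := by
  induction S, hS using Set.Finite.induction_on with
  | empty => exact SDef.of_hier (Hier.falsum _ _) fun x => by simp
  | insert _ _ ih => exact SDef.or (SDef.eq (SFun.var 0) (SFun.const _)) ih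

theorem exists_axiomCodes_Q (n : ℕ) : ∃ P, SDef₁ n P ∧ AxiomCodes Q P := by
  refine ⟨fun m => m ∈ code (k := 0) '' Q, SDef.of_finite (Set.Finite.image _ ?_), fun m => Iff.rfl⟩
  unfold Q
  exact Set.toFinite _

theorem SDef.not {n k : ℕ} {R : (Fin k → ℕ) → Prop} (h : SDef n R) :
    SDef (n + 1) fun x => ¬ R x := by
  obtain ⟨φ, hφ, h⟩ := h
  exact SDef.of_hier (Hier.all (.up (Hier.not hφ)) : Hier .pi (n + 1) φ.not.all) fun x => by
    simp [h]

/-- This avoids partial truth definitions. `Q` is true and proves every true bounded sentence, so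
truth of bounded sentences is provability in `Q`. Likewise `Q ∪ PiTh n` is true and refutes every
false `Π_{n+1}`-sentence, so truth of these is irrefutability in it; the negation raises the level
by exactly one. -/
theorem exists_axiomCodes_piTh (n : ℕ) : ∃ P, SDef₁ n P ∧ AxiomCodes (PiTh n) P := by
  induction n with
  | zero =>
    obtain ⟨P, hP, hQ⟩ := exists_axiomCodes_Q 0
    refine ⟨fun c => (∃ φ : lang.Sentence, code (k := 0) φ = c ∧ IsPi 0 (k := 0) φ) ∧
      ∃ φ : lang.Sentence, code (k := 0) φ = c ∧ Proves Q φ, (sdef_isPiCode 0 0).and (sdef_provable hQ hP), fun m => ?_⟩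
    constructor
    · rintro ⟨⟨φ, rfl, hφ⟩, ψ, hc, hψ⟩
      obtain rfl : ψ = φ := code_injective hc
      exact ⟨ψ, ⟨hφ, hψ.models nat_models_Q⟩, rfl⟩
    · rintro ⟨φ, hφ, rfl⟩
      exact ⟨⟨φ, rfl, hφ.1⟩, φ, rfl, proves_of_models fun M _ _ hM =>
        (models_piTh_zero (models_Q_iff.1 hM)).realize_of_mem _ hφ⟩
  | succ n ih =>
    obtain ⟨P, hP, hQ⟩ := exists_axiomCodes_Q n
    obtain ⟨P', hP', hQ'⟩ := ih
    have hprov := sdef_provable (hQ.union hQ') (hP.or hP')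
    refine ⟨fun c => (∃ φ : lang.Sentence, code (k := 0) φ = c ∧ IsPi (n + 1) (k := 0) φ) ∧
      ¬ ∃ φ : lang.Sentence, code (k := 0) φ = cNot c ∧ Proves (Q ∪ PiTh n) φ,
      (sdef_isPiCode (n + 1) (n + 1)).and (SDef.not (hprov.comp (f := fun x : Fin 1 → ℕ =>
      cNot (x 0)) ((SFun.const 3).pair ((SFun.var 0).pair (SFun.const _))))), fun m => ?_⟩
    constructor
    · rintro ⟨⟨φ, rfl, hφ⟩, h⟩
      refine ⟨φ, ⟨hφ, ?_⟩, rfl⟩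
      by_contra hfalse
      refine h ⟨_, rfl, proves_of_models fun M _ _ hM => (models_not_iff φ).2 fun hφM => hfalse ?_⟩
      exact isTrue_of_isPi (models_Q_iff.1 (hM.mono Set.subset_union_left))
        (fun m hm => by cases hm; exact hM.mono Set.subset_union_right) hφ hφM
    · rintro ⟨φ, hφ, rfl⟩
      refine ⟨⟨φ, rfl, hφ.1⟩, ?_⟩
      rintro ⟨ψ, hc, hψ⟩
      obtain rfl : ψ = FirstOrder.Language.BoundedFormula.not (n := 0) φ := code_injective hc
      exact (models_not_iff φ).1 (hψ.models
        (FirstOrder.Language.Theory.Model.union nat_models_Q (nat_models_piTh n))) hφ.2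

theorem exists_axiomCodes_of_piDefinable {n : ℕ} {T : lang.Theory} (hT : PiDefinable n T) :
    ∃ P, SDef₁ n P ∧ AxiomCodes T P := by
  obtain ⟨α, hα, h⟩ := hT
  refine ⟨_, SDef.of_hier (R := fun x => Sat α fun _ => x 0) hα fun x => ?_, h⟩
  rw [show (fun _ : Fin 1 => x 0) = x from funext fun i => congrArg x (Subsingleton.elim 0 i)]

/-! ## Consistency with the true `Π_n`-sentences -/

/-- The negation of a false `Σ_n`-sentence is an axiom of `PiTh n`. -/
theorem SigmaSound.of_consistent {n : ℕ} {T : lang.Theory} (h : Consistent (T ∪ PiTh n)) :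
    SigmaSound n T := by
  intro φ hφ hT
  by_contra hfalse
  refine h (.mp (φ := φ) (proves_of_models fun M _ _ hM => ?_) (hT.mono Set.subset_union_left))
  exact hM.realize_of_mem (FirstOrder.Language.BoundedFormula.not (n := 0) φ)
    (Or.inr ⟨Hier.not hφ, (models_not_iff φ).2 hfalse⟩)

theorem exists_isPi_conj (n : ℕ) (S : Finset lang.Sentence) (hS : ∀ φ ∈ S, φ ∈ PiTh n) :
    ∃ π ∈ PiTh n, ∀ (M : Type) [lang.Structure M], M ⊨ π → ∀ φ ∈ S, M ⊨ φ := by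
  classical
  induction S using Finset.induction_on with
  | empty =>
    exact ⟨FirstOrder.Language.BoundedFormula.not (n := 0) ⊥,
      ⟨Hier.not (Hier.falsum _ _), (models_not_iff _).2 id⟩, by simp⟩
  | insert φ S _ ih =>
    obtain ⟨π, hπ, h⟩ := ih fun ψ hψ => hS ψ (Finset.mem_insert_of_mem hψ)
    have hφ := hS φ (Finset.mem_insert_self _ _)
    have key : ∀ (M : Type) [lang.Structure M], M ⊨ (φ ⊓ π) ↔ M ⊨ φ ∧ M ⊨ π := fun M _ => by
      simp only [models_iff_sat _ (Fin.elim0 : Fin 0 → M)]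
      exact sat_inf _ _ _
    refine ⟨φ ⊓ π, ⟨Hier.inf hφ.1 hπ.1, (key ℕ).2 ⟨hφ.2, hπ.2⟩⟩, fun M _ hM ψ hψ => ?_⟩
    rcases Finset.mem_insert.1 hψ with rfl | hψ
    · exact ((key M).1 hM).1
    · exact h M ((key M).1 hM).2 ψ hψ

/-- By compactness, an inconsistency uses finitely many sentences of `PiTh n`. With `π` their
conjunction, `T` proves `π.not`, a false `Σ_n`-sentence. -/
theorem consistent_union_piTh {n : ℕ} {T : lang.Theory} (h : SigmaSound n T) :
    Consistent (T ∪ PiTh n) := by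
  classical
  suffices (T ∪ PiTh n).IsSatisfiable by
    obtain ⟨M⟩ := this
    exact consistent_of_models M.is_model
  rw [FirstOrder.Language.Theory.isSatisfiable_iff_isFinitelySatisfiable]
  intro T₀ hT₀
  obtain ⟨π, hπ, hS⟩ := exists_isPi_conj n (T₀.filter (· ∈ PiTh n)) fun φ hφ =>
    (Finset.mem_filter.1 hφ).2
  by_contra hunsat
  refine (models_not_iff (M := ℕ) π).1 (h _ (Hier.not hπ.1) (proves_of_models fun M _ _ hM => ?_))
    hπ.2
  rw [models_not_iff]
  intro hMπ
  have : M ⊨ (T₀ : lang.Theory) := ⟨fun φ hφ => by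
    rcases hT₀ hφ with h' | h'
    · exact hM.realize_of_mem _ h'
    · exact hS M hMπ φ (Finset.mem_filter.2 ⟨hφ, h'⟩)⟩
  exact hunsat (FirstOrder.Language.Theory.Model.isSatisfiable M)

/-! ## Rosser's theorem -/

/-- The number `e` is the code of a formula `φ` such that `U` proves `φ(e)`, or `¬ φ(e)`. -/
def DiagProves (U : lang.Theory) (c : ℕ → ℕ) (e : ℕ) : Prop :=
  ∃ t d, t = codeTm (num e : Tm 0) ∧ SubstFmRel instRel (Nat.pair 0 t) e d ∧
    ∃ φ : lang.Sentence, code (k := 0) φ = c d ∧ Proves U φ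

/-- Used with `f` the identity (proofs) and `f` negation (refutations). -/
theorem diagProves_iff {U : lang.Theory} {c : ℕ → ℕ} (f : lang.Sentence → lang.Sentence)
    (hf : ∀ φ : lang.Sentence, code (k := 0) (f φ) = c (code (k := 0) φ)) (φ : Fm 1) :
    DiagProves U c (code φ) ↔ Proves U (f (inst φ (num (code φ)))) := by
  constructor
  · rintro ⟨t, d, rfl, hd, ψ, hψ, h⟩
    rw [substFmRel_inst] at hd
    subst hd
    rw [← hf] at hψ
    rwa [← code_injective hψ]
  · intro h
    exact ⟨_, _, rfl, (substFmRel_inst _ _ _).2 rfl, _, hf _, h⟩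

theorem sdef_diagProves {n : ℕ} {U : lang.Theory}
    (hU : SDef₁ n fun c => ∃ φ : lang.Sentence, code (k := 0) φ = c ∧ Proves U φ) {c : ℕ → ℕ}
    (hc : ∀ {k : ℕ} {f : (Fin k → ℕ) → ℕ}, SFun n f → SFun n fun x => c (f x)) :
    SDef₁ n (DiagProves U c) := by
  unfold DiagProves
  repeat' with_reducible first
    | apply SFun.var | apply SFun.const
    | apply SDef.comp hU
    | apply SDef.comp₂ (sfun_codeTm_num n 0)
    | apply SDef.and | apply SDef.ex | apply SDef.comp₃ (sdef_substFmRel (sdef_instRel n))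
    | apply SFun.pair | apply hc

/-- The Rosser formula `∃ y (b(x, y) ∧ ∀ z ≤ y, ¬ a(x, z))`. -/
def rosser (a b : Fm 2) : Fm 1 := (b ⊓ ballLE (v 1) (subst a ![v 0, v (2 : Fin 3)]).not).ex

/-- The matrix combines the `Π_n`-formula `b` with the negation of the `Π_n`-formula `a`; both fit
in `Σ_{n+1}`, where the bounded quantifier is free. -/
theorem rosser_isSigma {n : ℕ} {a b : Fm 2} (ha : IsPi n a) (hb : IsPi n b) :
    IsSigma (n + 1) (rosser a b) :=
  .ex (Hier.inf (.up hb) (.ballLE _ (Hier.not (ha.succ.subst _))))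

theorem sat_rosser {M : Type*} [lang.Structure M] (a b : Fm 2) (x : M) :
    Sat (rosser a b) (fun _ => x) ↔
      ∃ y, Sat b ![x, y] ∧ ∀ z, mle z y → ¬ Sat a ![x, z] := by
  have h₁ : ∀ y : M, (Fin.snoc (α := fun _ => M) (fun _ : Fin 1 => x) y : Fin 2 → M) = ![x, y] :=
    fun y => funext fun i => by fin_cases i <;> rfl
  have h₂ : ∀ y z : M, (fun i => val ((![v 0, v (2 : Fin 3)] : Fin 2 → Tm 3) i)
      (Fin.snoc (α := fun _ => M) ![x, y] z)) = ![x, z] :=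
    fun y z => funext fun i => by fin_cases i <;> rfl
  simp only [rosser, sat_ex, sat_inf, sat_ballLE, sat_not, sat_subst, h₁, h₂, val_var]
  rfl

theorem models_inst_num {M : Type*} [lang.Structure M] (φ : Fm 1) (m : ℕ) :
    M ⊨ (inst φ (num m) : lang.Sentence) ↔ Sat φ fun _ => mnum M m := by
  rw [models_iff_sat _ Fin.elim0, sat_inst, val_num]
  refine iff_of_eq (congrArg _ (funext fun i => ?_))
  rw [show i = Fin.last 0 from Fin.ext (by simp), Fin.snoc_last]

theorem mnum_vec (M : Type*) [lang.Structure M] (i j : ℕ) :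
    (fun l => mnum M (![i, j] l)) = ![mnum M i, mnum M j] :=
  funext fun l => by fin_cases l <;> rfl

/-- A consistent theory with `Q` and the true `Π_n`-sentences whose provability is
`Σ_{n+1}`-definable leaves some true `Π_{n+1}`-sentence undecided. -/
theorem exists_undecided {n : ℕ} {U : lang.Theory} (hQ : ExtendsQ U) (hPi : PiTh n ⊆ U)
    (hcons : Consistent U)
    (hU : SDef₁ n fun c => ∃ φ : lang.Sentence, code (k := 0) φ = c ∧ Proves U φ) :
    ∃ γ : lang.Sentence, IsPi (n + 1) (k := 0) γ ∧ IsTrue γ ∧ ¬ Decides U γ := by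
  obtain ⟨a, ha, hA⟩ := sdef_diagProves hU (c := id) fun h => h
  obtain ⟨b, hb, hB⟩ := sdef_diagProves hU (c := cNot)
    fun h => (SFun.const 3).pair (h.pair (SFun.const _))
  have hvec : ∀ e y : ℕ, (Fin.snoc (α := fun _ => ℕ) (fun _ : Fin 1 => e) y : Fin 2 → ℕ) =
      ![e, y] := fun e y => funext fun i => by fin_cases i <;> rfl
  have hA' : ∀ e, DiagProves U id e ↔ ∃ y, Sat a ![e, y] := fun e => by
    simpa only [hvec] using hA fun _ => e
  have hB' : ∀ e, DiagProves U cNot e ↔ ∃ y, Sat b ![e, y] := fun e => by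
    simpa only [hvec] using hB fun _ => e
  -- Diagonalization: `δ` is `ρ` applied to its own code `r`, so `a` and `b` at `r` speak of proofs
  -- and refutations of `δ` itself.
  generalize hρ : rosser a b = ρ
  generalize hr : code ρ = r
  generalize hδ : (inst ρ (num r) : lang.Sentence) = δ
  have hAr : Proves U δ ↔ ∃ y, Sat a ![r, y] := by
    rw [← hA', ← hδ, ← hr, diagProves_iff id fun _ => rfl]; rfl
  have hBr : Proves U (FirstOrder.Language.BoundedFormula.not (n := 0) δ) ↔
      ∃ y, Sat b ![r, y] := by
    rw [← hB', ← hδ, ← hr, diagProves_iff (FirstOrder.Language.BoundedFormula.not (n := 0))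
      fun _ => rfl]
  have hδs : IsSigma (n + 1) (k := 0) δ := by
    rw [← hδ, ← hρ]
    exact (rosser_isSigma ha hb).subst _
  have hsat : ∀ (M : Type) [lang.Structure M], M ⊨ δ ↔
      ∃ y : M, Sat b ![mnum M r, y] ∧ ∀ z, mle z y → ¬ Sat a ![mnum M r, z] := fun M _ => by
    rw [← hδ, models_inst_num, ← hρ, sat_rosser]
  have hM' : ∀ (M : Type) [lang.Structure M], M ⊨ U → ∀ m, n + 1 = m + 1 → M ⊨ PiTh m := by
    intro M _ hM m hm
    cases hm
    exact hM.mono hPi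
  have hexcl : Proves U δ → ¬ Proves U (FirstOrder.Language.BoundedFormula.not (n := 0) δ) :=
    fun h₁ h₂ => hcons (.mp h₂ h₁)
  -- A refutation witness without any proof witness makes the `Σ_{n+1}`-sentence `δ` true, hence
  -- provable in `U`.
  have hBA : (∃ y, Sat b ![r, y]) → (¬ ∃ y, Sat a ![r, y]) → Proves U δ := by
    rintro ⟨y, hy⟩ hna
    refine proves_of_models fun M _ _ hM => models_of_isSigma (hQ.qModel hM) (hM' M hM) hδs ?_
    refine (hsat ℕ).2 ⟨y, by rwa [mnum_nat], fun z _ hz => hna ⟨z, ?_⟩⟩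
    rwa [mnum_nat] at hz
  have hAB : (∃ y, Sat a ![r, y]) → (¬ ∃ y, Sat b ![r, y]) →
      Proves U (FirstOrder.Language.BoundedFormula.not (n := 0) δ) := by
    rintro ⟨N, hN⟩ hnb
    refine proves_of_models fun M _ _ hM => (models_not_iff δ).2 fun hMδ => ?_
    have hMQ := hQ.qModel hM
    obtain ⟨y, hy, hz⟩ := (hsat M).1 hMδ
    have hMN := (Hier.transfer hMQ (.up ha : Hier .sigma (n + 1) a) (hM' M hM) ![r, N]).1 rfl hN
    rw [mnum_vec] at hMN
    -- If `y ≤ N`, then `y` is standard and, `b` being `Π_n`, it would be a genuine refutation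
    -- witness. If `N ≤ y`, then `N` is a proof witness at or below `y`, which `δ` forbids.
    rcases hMQ.mle_mnum_total y N with hle | hle
    · obtain ⟨i, -, rfl⟩ := hMQ.exists_eq_mnum hle
      refine hnb ⟨i, (Hier.transfer hMQ hb.succ (hM' M hM) ![r, i]).2 rfl ?_⟩
      rwa [mnum_vec]
    · exact hz _ hle hMN
  -- A proof of `δ` gives a proof witness, and consistency excludes a refutation witness; then `hAB`
  -- refutes `δ`, a contradiction.
  have hnA : ¬ Proves U δ := fun h =>
    hexcl h (hAB (hAr.1 h) fun h' => hexcl h (hBr.2 h'))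
  have hnB : ¬ Proves U (FirstOrder.Language.BoundedFormula.not (n := 0) δ) := fun h =>
    hnA (hBA (hBr.1 h) fun h' => hnA (hAr.2 h'))
  refine ⟨FirstOrder.Language.BoundedFormula.not (n := 0) δ, Hier.not hδs,
    (models_not_iff δ).2 fun h => ?_, ?_⟩
  -- If `δ` were true, its witness would be a genuine refutation witness, but `U` does not refute
  -- `δ`.
  · obtain ⟨y, hy, -⟩ := (hsat ℕ).1 h
    rw [mnum_nat] at hy
    exact hnB (hBr.2 ⟨y, hy⟩)
  · rintro (h | h)
    · exact hnB h
    · exact hnA (.mp (.dne _) h)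

end Arith

/-! ### The main theorem -/

theorem mainTheorem1 (n : ℕ) (T : FirstOrder.Language.Theory Arith.lang)
    (hQ : Arith.ExtendsQ T) (hT : Arith.PiDefinable n T) :
    (Arith.Consistent (T ∪ Arith.PiTh n) ↔ Arith.SigmaSound n T) ∧
    (n = 0 → (Arith.Consistent (T ∪ Arith.PiTh n) ↔ Arith.Consistent T)) ∧
    (Arith.Consistent (T ∪ Arith.PiTh n) →
      ¬ Arith.PiDeciding (n + 1) T ∧
      ∃ γ : FirstOrder.Language.Sentence Arith.lang,
        Arith.IsPi (n + 1) (k := 0) γ ∧ Arith.IsTrue γ ∧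
        ¬ Arith.Decides T γ ∧ ¬ Arith.Decides (T ∪ Arith.PiTh n) γ) := by
  refine ⟨⟨Arith.SigmaSound.of_consistent, Arith.consistent_union_piTh⟩, ?_, fun hcons => ?_⟩
  · rintro rfl
    refine ⟨Arith.Consistent.mono Set.subset_union_left, fun h => ?_⟩
    obtain ⟨M, _, _, hM⟩ := Arith.exists_model_of_consistent h
    exact Arith.consistent_of_models
      (FirstOrder.Language.Theory.Model.union hM (Arith.models_piTh_zero (hQ.qModel hM)))
  · obtain ⟨P, hP, hTP⟩ := Arith.exists_axiomCodes_of_piDefinable hT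
    obtain ⟨P', hP', hTP'⟩ := Arith.exists_axiomCodes_piTh n
    obtain ⟨γ, hγ, htrue, hU⟩ := Arith.exists_undecided
      (fun φ hφ => (hQ φ hφ).mono Set.subset_union_left) Set.subset_union_right hcons
      (Arith.sdef_provable (hTP.union hTP') (hP.or hP'))
    have hT' : ¬ Arith.Decides T γ := fun h =>
      hU (h.imp (·.mono Set.subset_union_left) (·.mono Set.subset_union_left))
    exact ⟨fun h => hT' (h γ hγ), γ, hγ, htrue, hT', hU⟩
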